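/- Let $m,n$ be integers with $0<m\le |n|$, let $d=\gcd(m,n)$, and let $G=BS(m,n)=\langle a,t \mid t^{-1}a^mt=a^n\rangle$. Assume that $G$ is not residually finite. Let $R$ be the intersection of all subgroups of finite index in $G$, let $\overline{A}$ be the subgroup of $\overline{G}=G/R$ generated by the images of the elements $t^ka^dt^{-k}$, $k\in\mathbb{Z}$, and let $A\le G$ be the preimage of $\overline{A}$ (so $A\ge R$ and $A/R=\overline{A}$). Let $\gamma_1G=G$, $\gamma_{i+1}G=[\gamma_iG,G]$, $G'=\gamma_2G$ and $\gamma_\omega G=\bigcap_{i\ge1}\gamma_iG$. Write $\mathbb{Z}_k$ for the cyclic group of order $k$, $*$ for the free product, and $F_\infty$ for the free group of countably infinite rank. Then $A$ is normal in $G$, $$G\ge G'A\ge A\ge R,\qquad G\ge G'\ge\gamma_\omega G\ge R,$$ and $A/R$ is abelian. Moreover: 1) If $n-m\ge d>1$, then $G/G'A\cong\mathbb{Z}\times\mathbb{Z}_d$, $G/A\cong\mathbb{Z}*\mathbb{Z}_d$, $G/G'\cong\mathbb{Z}\times\mathbb{Z}_{n-m}$ and $G'A/A\cong F_\infty$. 2)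 If $n-m>d=1$, then $A$ contains $G'$ as a proper subgroup, $G/A\cong\mathbb{Z}$ and $A/G'\cong\mathbb{Z}_{n-m}$. 3) If $n-m=d=1$, then $G'=A=\gamma_\omega G$. 4) If $d=p^k$ for some prime $p$ and some integer $k\ge0$, then $G\ge G'A\ge A\ge\gamma_\omega G\ge R$. 5) If $n=m+d$ and $d=p^k$ for some prime $p$ and some integer $k\ge0$, then $G\ge G'\ge A\ge\gamma_\omega G\ge R$. -/

import Mathlib

/-- The two generators of a Baumslag-Solitar group. -/
inductive BSGen : Type
  | a
  | t

/-- The Baumslag-Solitar group `BS(m, n) = ⟨a, t ∣ t⁻¹ a ^ m t = a ^ n⟩`. -/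
abbrev BS (m n : ℤ) : Type :=
  PresentedGroup
    ({(FreeGroup.of BSGen.t)⁻¹ * FreeGroup.of BSGen.a ^ m * FreeGroup.of BSGen.t *
      (FreeGroup.of BSGen.a ^ n)⁻¹} : Set (FreeGroup BSGen))

namespace BS

/-- The generator `a` of `BS(m, n)`. -/
def a (m n : ℤ) : BS m n := PresentedGroup.of BSGen.a

/-- The generator `t` of `BS(m, n)`. -/
def t (m n : ℤ) : BS m n := PresentedGroup.of BSGen.t

end BS

/-- The finite residual of a group: the intersection of all its subgroups of finite index. -/
def finiteResidual (G : Type*) [Group G] : Subgroup G :=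
  sInf {H : Subgroup G | H.FiniteIndex}

instance finiteResidual_normal (G : Type*) [Group G] : (finiteResidual G).Normal := by
  constructor
  intro x hx g
  rw [finiteResidual, Subgroup.mem_sInf] at hx ⊢
  intro H hH
  have hH' : H.FiniteIndex := hH
  have h := hx H.normalCore (show H.normalCore.FiniteIndex from inferInstance)
  exact H.normalCore_le ((inferInstance : H.normalCore.Normal).conj_mem x h g)

/-- `γ_ω G`, the intersection of all terms of the lower central series of `G`. -/
def gammaOmega (G : Type*) [Group G] : Subgroup G :=
  ⨅ i : ℕ, Subgroup.lowerCentralSeries (⊤ : Subgroup G) i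

namespace BS

/-- The subgroup of the quotient of `G = BS(m, n)` by its finite residual `R` that is generated by
the images of the elements `t ^ k * a ^ d * t ^ (-k)`, where `k ∈ ℤ` and `d = gcd(m, n)`. -/
def Abar (m n : ℤ) : Subgroup (BS m n ⧸ finiteResidual (BS m n)) :=
  Subgroup.closure (Set.range fun k : ℤ =>
    ((t m n ^ k * a m n ^ Int.gcd m n * t m n ^ (-k) : BS m n) :
      BS m n ⧸ finiteResidual (BS m n)))

/-- The preimage in `G = BS(m, n)` of `Abar m n`, that is, the subgroup `A ≥ R` of `G` such that
`A / R` is `Abar m n`. -/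
def A (m n : ℤ) : Subgroup (BS m n) :=
  (Abar m n).comap (QuotientGroup.mk' (finiteResidual (BS m n)))

end BS

/-! The core is that `A` is the normal closure of `a ^ d`, so that `G / A` is `ℤ * ℤ_d`
(`BS.ker_toCoprod_eq_A`). In a finite quotient the conjugate elements `a ^ m` and `a ^ n` have equal
order, so they generate the same subgroup of the cyclic group `⟨a⟩`, namely `⟨a ^ d⟩`. Hence `t`
normalizes `⟨a ^ d⟩` there, and modulo `R` the elements `t ^ k * a ^ d * t ^ (-k)` commute with each
other and with `a`. This makes `A / R` abelian and `A` normal. Killing `a ^ d` makes the defining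
relation void and leaves `ℤ * ℤ_d`. That group is residually finite, for `d > 1` as an extension of
a free group of rank `d` by `ℤ_d`, so `R` lies in the kernel and the kernel is exactly `A`.

The quotients in 1) and 2) come from exponent sums and from the kernel of `ℤ * ℤ_d → ℤ × ℤ_d`, which
is free of infinite rank.

The bound `R ≤ γ_ω G` holds because finitely generated nilpotent groups are residually finite. The
bound `γ_ω G ≤ A` for `d = p ^ k` is residual nilpotence of `ℤ * ℤ_d`: send generators to `1 + X i`
in noncommuting power series over `𝔽_p`. This is faithful by ping-pong on the number of blocks of a
word (`Magnus.lift_rep_injective`). Conversely, the relation reads `a ^ (n - m) = ⁅a ^ (-m), t⁻¹⁆`;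
for `n - m = 1` it carries `a` down the whole lower central series. -/

/-! ### Residual finiteness of finitely generated nilpotent groups -/

section NilpotentGroups

open Subgroup
open scoped commutatorElement IsMulCommutative

variable {G : Type*} [Group G]

theorem pow_mul_eq_commutatorElement_pow {z s : G} (h : ⁅z, s⁆ ∈ center G) (k : ℕ) :
    z ^ k * s = ⁅z, s⁆ ^ k * s * z ^ k := by
  induction k with
  | zero => simp
  | succ k ih =>
    have h1 : z * s = ⁅z, s⁆ * s * z := by simp [commutatorElement_def]
    have h2 := (Subgroup.mem_center_iff.mp h (z ^ k))
    calc z ^ (k + 1) * s = z ^ k * (z * s) := by rw [pow_succ, mul_assoc]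
      _ = z ^ k * ⁅z, s⁆ * s * z := by rw [h1]; simp only [mul_assoc]
      _ = ⁅z, s⁆ * (z ^ k * s) * z := by rw [h2]; simp only [mul_assoc]
      _ = ⁅z, s⁆ ^ (k + 1) * s * z ^ (k + 1) := by
        rw [ih, pow_succ', pow_succ]; simp only [mul_assoc]

/-- If the center of a finitely generated group is a torsion group, then so is the second center. -/
theorem isOfFinOrder_of_forall_commutatorElement_mem_center [Group.FG G]
    (hZ : ∀ z ∈ center G, IsOfFinOrder z) {z : G} (hz : ∀ s, ⁅z, s⁆ ∈ center G) :
    IsOfFinOrder z := by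
  obtain ⟨S, hS⟩ := Group.fg_def.mp ‹Group.FG G›
  set e := ∏ s ∈ S, orderOf ⁅z, s⁆ with he
  have hpos : e ≠ 0 := Finset.prod_ne_zero_iff.mpr fun s _ => (hZ _ (hz s)).orderOf_pos.ne'
  have hcomm : ∀ s ∈ S, z ^ e * s = s * z ^ e := by
    intro s hs
    rw [pow_mul_eq_commutatorElement_pow (hz s),
      orderOf_dvd_iff_pow_eq_one.mp (Finset.dvd_prod_of_mem (fun s => orderOf ⁅z, s⁆) hs), one_mul]
  have hle : closure (S : Set G) ≤ centralizer {z ^ e} := by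
    rw [closure_le]
    intro s hs
    exact mem_centralizer_singleton_iff.mpr (hcomm s hs).symm
  have hmem : z ^ e ∈ center G := by
    rw [mem_center_iff]
    intro g
    have := hle (hS ▸ mem_top g)
    exact mem_centralizer_singleton_iff.mp this
  exact (hZ _ hmem).of_pow hpos

/-- Induction on the nilpotency class: by the preceding lemma the center of `G ⧸ center G` is again
torsion. -/
theorem isMulTorsion_of_forall_mem_center [Group.IsNilpotent G] :
    Group.FG G → (∀ z ∈ center G, IsOfFinOrder z) → IsMulTorsion G := by
  refine Group.nilpotent_center_quotient_ind
    (P := fun G _ _ => Group.FG G → (∀ z ∈ center G, IsOfFinOrder z) → IsMulTorsion G) G ?_ ?_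
  · intro G _ _ _ _ g
    rw [Subsingleton.elim g 1]
    exact IsOfFinOrder.one
  · intro G _ _ ih hfg hZ
    have hq : IsMulTorsion (G ⧸ center G) := by
      refine ih inferInstance fun z hz => ?_
      obtain ⟨z, rfl⟩ := QuotientGroup.mk_surjective z
      refine MonoidHom.isOfFinOrder (QuotientGroup.mk' (center G))
        (isOfFinOrder_of_forall_commutatorElement_mem_center hZ fun s => ?_)
      have := mem_center_iff.mp hz (s : G ⧸ center G)
      rw [← QuotientGroup.eq_one_iff]
      change ⁅(z : G ⧸ center G), (s : G ⧸ center G)⁆ = 1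
      exact commutatorElement_eq_one_iff_mul_comm.mpr this.symm
    intro g
    obtain ⟨k, hk, hgk⟩ := isOfFinOrder_iff_pow_eq_one.mp (hq (g : G ⧸ center G))
    have hmem : g ^ k ∈ center G := by
      rw [← QuotientGroup.eq_one_iff]
      exact hgk
    exact (hZ _ hmem).of_pow hk.ne'

/-- By induction the center has finite index, so it is itself finitely generated; being abelian and
torsion, it is finite. -/
theorem finite_of_fg_of_isNilpotent_of_isMulTorsion [Group.IsNilpotent G] :
    Group.FG G → IsMulTorsion G → Finite G := by
  refine Group.nilpotent_center_quotient_ind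
    (P := fun G _ _ => Group.FG G → IsMulTorsion G → Finite G) G ?_ ?_
  · intro G _ _ _ _
    infer_instance
  · intro G _ _ ih hfg ht
    have : Finite (G ⧸ center G) :=
      ih inferInstance (ht.of_surjective (QuotientGroup.mk'_surjective (center G)))
    have : (center G).FiniteIndex := finiteIndex_of_finite_quotient
    have : Finite (center G) :=
      CommGroup.finite_of_fg_isMulTorsion (G := center G) (IsMulTorsion.subgroup ht _)
    exact Finite.of_subgroup_quotient (center G)

/-- In a finitely generated nilpotent group in which all nontrivial normal subgroups share a
nontrivial element, every element has finite order, so that the group is finite. -/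
theorem finite_of_isNilpotent_of_forall_normal_mem [Group.FG G] [Group.IsNilpotent G] {x : G}
    (hx : x ≠ 1) (h : ∀ N : Subgroup G, N.Normal → N ≠ ⊥ → x ∈ N) : Finite G := by
  refine finite_of_fg_of_isNilpotent_of_isMulTorsion inferInstance
    (isMulTorsion_of_forall_mem_center inferInstance fun z hz => ?_)
  by_contra hinf
  have key : ∀ k : ℤ, k ≠ 0 → x ∈ zpowers (z ^ k) := by
    intro k hk
    have hzk : z ^ k ∈ center G := zpow_mem hz k
    refine h _ ⟨fun y hy g => ?_⟩ ?_
    · have : y ∈ center G := (zpowers_le.mpr hzk) hy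
      rwa [mem_center_iff.mp this g, mul_inv_cancel_right]
    · rw [Ne, zpowers_eq_bot]
      intro h1
      exact hinf (isOfFinOrder_iff_zpow_eq_one.mpr ⟨k, hk, h1⟩)
  obtain ⟨k, hk⟩ := mem_zpowers_iff.mp (key 1 one_ne_zero)
  rw [zpow_one] at hk
  have hk0 : k ≠ 0 := by
    rintro rfl
    exact hx (by rw [← hk, zpow_zero])
  -- Here `x = z ^ k` with `z` of infinite order, so `x` cannot be a power of `z ^ (2 * k)`.
  obtain ⟨j, hj⟩ := mem_zpowers_iff.mp (key (2 * k) (by omega))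
  rw [← zpow_mul, ← hk] at hj
  have := (injective_zpow_iff_not_isOfFinOrder.mpr hinf) hj
  have h2 : k * (2 * j - 1) = 0 := by linear_combination this
  rcases mul_eq_zero.mp h2 with h2 | h2 <;> omega

theorem finiteResidual_eq_bot_iff :
    finiteResidual G = ⊥ ↔ ∀ x : G, x ≠ 1 → ∃ H : Subgroup G, H.FiniteIndex ∧ x ∉ H := by
  rw [eq_bot_iff]
  constructor
  · intro h x hx
    by_contra! hc
    exact hx (Subgroup.mem_bot.mp (h (Subgroup.mem_sInf.mpr fun H hH => hc H hH)))
  · intro h x hx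
    by_contra hx1
    obtain ⟨H, hH, hxH⟩ := h x hx1
    exact hxH (Subgroup.mem_sInf.mp hx H hH)

/-- Finitely generated nilpotent groups are residually finite. -/
theorem finiteResidual_eq_bot_of_isNilpotent [Group.FG G] [Group.IsNilpotent G] :
    finiteResidual G = ⊥ := by
  rw [finiteResidual_eq_bot_iff]
  intro x hx
  -- For `N` normal and maximal with `x ∉ N`, every nontrivial normal subgroup of `G ⧸ N` contains
  -- the image of `x`, so `G ⧸ N` is finite.
  obtain ⟨N, -, hN⟩ := zorn_le_nonempty₀ {N : Subgroup G | N.Normal ∧ x ∉ N} (by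
    intro c hc hchain N₀ hN₀
    have hne : c.Nonempty := ⟨N₀, hN₀⟩
    refine ⟨sSup c, ⟨?_, ?_⟩, fun N hN => le_sSup hN⟩
    · refine ⟨fun y hy g => ?_⟩
      rw [mem_sSup_of_directedOn hne hchain.directedOn] at hy ⊢
      obtain ⟨K, hK, hyK⟩ := hy
      exact ⟨K, hK, (hc hK).1.conj_mem y hyK g⟩
    · rw [mem_sSup_of_directedOn hne hchain.directedOn]
      rintro ⟨K, hK, hxK⟩
      exact (hc hK).2 hxK) ⊥ ⟨inferInstance, by simpa using hx⟩
  obtain ⟨⟨hnormal, hxN⟩, hmax⟩ := hN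
  refine ⟨N, ?_, hxN⟩
  have : Finite (G ⧸ N) := by
    refine finite_of_isNilpotent_of_forall_normal_mem (x := (x : G ⧸ N))
      (by rwa [Ne, QuotientGroup.eq_one_iff]) fun M hM hMbot => ?_
    by_contra hxM
    have hle : M.comap (QuotientGroup.mk' N) ≤ N := hmax ⟨hM.comap _, hxM⟩ (by
      intro y hy
      rw [mem_comap, QuotientGroup.mk'_apply, (QuotientGroup.eq_one_iff y).mpr hy]
      exact one_mem M)
    refine hMbot (eq_bot_iff.mpr fun y hy => ?_)
    obtain ⟨y, rfl⟩ := QuotientGroup.mk_surjective y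
    exact Subgroup.mem_bot.mpr ((QuotientGroup.eq_one_iff y).mpr (hle hy))
  exact finiteIndex_of_finite_quotient

theorem map_mem_finiteResidual {H : Type*} [Group H] (f : G →* H) {x : G}
    (hx : x ∈ finiteResidual G) : f x ∈ finiteResidual H := by
  refine mem_sInf.mpr fun K hK => ?_
  have : K.FiniteIndex := hK
  exact mem_sInf.mp hx (K.comap f) (show (K.comap f).FiniteIndex from
    ⟨by rw [index_comap]; exact FiniteIndex.index_ne_zero (H := K.subgroupOf f.range)⟩)

theorem finiteResidual_eq_bot_of_injective {H : Type*} [Group H] {f : G →* H}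
    (hf : Function.Injective f) (hH : finiteResidual H = ⊥) : finiteResidual G = ⊥ := by
  refine eq_bot_iff.mpr fun x hx => ?_
  have := map_mem_finiteResidual f hx
  rw [hH, mem_bot] at this
  exact mem_bot.mpr (hf (this.trans (map_one f).symm))

theorem finiteResidual_le_ker {H : Type*} [Group H] (f : G →* H) (hH : finiteResidual H = ⊥) :
    finiteResidual G ≤ f.ker := by
  intro x hx
  have := map_mem_finiteResidual f hx
  rwa [hH, mem_bot] at this

theorem gammaOmega_le_ker {H : Type*} [Group H] (f : G →* H) (hH : gammaOmega H = ⊥) :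
    gammaOmega G ≤ f.ker := by
  intro x hx
  have : f x ∈ gammaOmega H := by
    refine mem_iInf.mpr fun i => ?_
    have h1 := mem_map_of_mem f (mem_iInf.mp hx i)
    rw [map_lowerCentralSeries] at h1
    exact lowerCentralSeries_mono i le_top h1
  rwa [hH, mem_bot] at this

theorem finiteResidual_le_gammaOmega [Group.FG G] : finiteResidual G ≤ gammaOmega G := by
  refine le_iInf fun i => ?_
  set L := Subgroup.lowerCentralSeries (⊤ : Subgroup G) i
  have : Group.IsNilpotent (G ⧸ L) := by
    rw [Subgroup.nilpotent_iff_lowerCentralSeries]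
    refine ⟨i, ?_⟩
    rw [← map_top_of_surjective _ (QuotientGroup.mk'_surjective L), ← map_lowerCentralSeries,
      Subgroup.map_eq_bot_iff, QuotientGroup.ker_mk']
  have h := finiteResidual_le_ker (QuotientGroup.mk' L) finiteResidual_eq_bot_of_isNilpotent
  rwa [QuotientGroup.ker_mk'] at h

theorem gammaOmega_le_commutator : gammaOmega G ≤ commutator G :=
  iInf_le _ 1

end NilpotentGroups

/-! ### Filtered rings and lower central series -/

section Filtration

open scoped commutatorElement

variable {S : Type*} [Ring S]

/-- The units `u` such that `u` and `u⁻¹` are congruent to `1` modulo the additive subgroup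
`I k`, where `I` is a filtration of a ring. -/
def congruenceUnits (I : ℕ → AddSubgroup S) (h1 : 1 ∈ I 0)
    (hmul : ∀ j k x y, x ∈ I j → y ∈ I k → x * y ∈ I (j + k)) (hle : ∀ k, I k ≤ I 0) (k : ℕ) :
    Subgroup Sˣ where
  carrier := {u | (u : S) - 1 ∈ I k ∧ ((u⁻¹ : Sˣ) : S) - 1 ∈ I k}
  one_mem' := by simp
  inv_mem' := by
    rintro u ⟨hu, hu'⟩
    exact ⟨hu', by simpa using hu⟩
  mul_mem' := by
    have key : ∀ x y : S, x - 1 ∈ I k → y - 1 ∈ I k → x * y - 1 ∈ I k := by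
      intro x y hx hy
      have hy0 : y ∈ I 0 := by simpa using add_mem (hle k hy) h1
      have := add_mem (hmul _ _ _ _ hx hy0) hy
      rw [add_zero] at this
      convert this using 1
      noncomm_ring
    rintro u v ⟨hu, hu'⟩ ⟨hv, hv'⟩
    refine ⟨?_, ?_⟩
    · rw [Units.val_mul]
      exact key _ _ hu hv
    · rw [mul_inv_rev, Units.val_mul]
      exact key _ _ hv' hu'

variable {I : ℕ → AddSubgroup S} {h1 : 1 ∈ I 0}
    {hmul : ∀ j k x y, x ∈ I j → y ∈ I k → x * y ∈ I (j + k)} {hle : ∀ k, I k ≤ I 0}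

/-- This rests on `⁅u, v⁆ - 1 = ((u - 1) * (v - 1) - (v - 1) * (u - 1)) * (u⁻¹ * v⁻¹)`. -/
theorem commutatorElement_mem_congruenceUnits {j k : ℕ} {u v : Sˣ}
    (hu : u ∈ congruenceUnits I h1 hmul hle j) (hv : v ∈ congruenceUnits I h1 hmul hle k) :
    ⁅u, v⁆ ∈ congruenceUnits I h1 hmul hle (j + k) := by
  have mem_zero : ∀ {i : ℕ} {x : S}, x - 1 ∈ I i → x ∈ I 0 := fun {i x} hx => by
    simpa using add_mem (hle i hx) h1
  have key : ∀ {i l : ℕ} {x y : Sˣ}, x ∈ congruenceUnits I h1 hmul hle i →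
      y ∈ congruenceUnits I h1 hmul hle l → ((⁅x, y⁆ : Sˣ) : S) - 1 ∈ I (i + l) := by
    intro i l x y hx hy
    have e : ((⁅x, y⁆ : Sˣ) : S) - 1 =
        (((x : S) - 1) * ((y : S) - 1) - ((y : S) - 1) * ((x : S) - 1)) *
          (((x⁻¹ : Sˣ) : S) * ((y⁻¹ : Sˣ) : S)) := by
      have e1 : ((x : S) - 1) * ((y : S) - 1) - ((y : S) - 1) * ((x : S) - 1) =
          ((x * y : Sˣ) : S) - ((y * x : Sˣ) : S) := by
        rw [Units.val_mul, Units.val_mul]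
        noncomm_ring
      rw [e1, ← Units.val_mul, sub_mul, ← Units.val_mul, ← Units.val_mul, commutatorElement_def]
      have e2 : y * x * (x⁻¹ * y⁻¹) = 1 := by group
      rw [e2, mul_assoc (x * y), Units.val_one]
    rw [e, ← add_zero (i + l)]
    refine hmul _ _ _ _ (sub_mem (hmul _ _ _ _ hx.1 hy.1) ?_) ?_
    · rw [add_comm]
      exact hmul _ _ _ _ hy.1 hx.1
    · exact hmul 0 0 _ _ (mem_zero hx.2) (mem_zero hy.2)
  refine ⟨key hu hv, ?_⟩
  rw [commutatorElement_inv, add_comm]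
  exact key hv hu

/-- A group that embeds into the group of units congruent to `1` with respect to a separated
filtration is residually nilpotent. -/
theorem gammaOmega_eq_bot_of_congruenceUnits {H : Type*} [Group H] {f : H →* Sˣ}
    (hf : Function.Injective f) (hf1 : ∀ x, f x ∈ congruenceUnits I h1 hmul hle 1)
    (hsep : ∀ x, (∀ k, x ∈ I (k + 1)) → x = 0) : gammaOmega H = ⊥ := by
  -- The index shifts by one because the lower central series is numbered from `0`.
  have key : ∀ i, ∀ x ∈ Subgroup.lowerCentralSeries (⊤ : Subgroup H) i,
      f x ∈ congruenceUnits I h1 hmul hle (i + 1) := by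
    intro i
    induction i with
    | zero => exact fun x _ => hf1 x
    | succ i ih =>
      change Subgroup.lowerCentralSeries (⊤ : Subgroup H) (i + 1) ≤
        (congruenceUnits I h1 hmul hle (i + 1 + 1)).comap f
      rw [Subgroup.lowerCentralSeries_succ, Subgroup.commutator_le]
      intro x hx y _
      rw [Subgroup.mem_comap, map_commutatorElement]
      exact commutatorElement_mem_congruenceUnits (ih x hx) (hf1 y)
  refine eq_bot_iff.mpr fun x hx => Subgroup.mem_bot.mpr (hf ?_)
  rw [map_one]
  ext
  rw [Units.val_one, ← sub_eq_zero]
  exact hsep _ fun k => (key k x (Subgroup.mem_iInf.mp hx k)).1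

/-- Expansion to first order of a power of a unit `1 + z`. -/
theorem exists_val_zpow_eq {z : S} {w : Sˣ} (hw : (w : S) = 1 + z) (u : ℤ) :
    ∃ s, ((w ^ u : Sˣ) : S) = 1 + u • z + z * z * s := by
  have hinv : ((w⁻¹ : Sˣ) : S) = 1 - z + z * z * ((w⁻¹ : Sˣ) : S) := by
    have h : ((w⁻¹ : Sˣ) : S) = 1 - z * ((w⁻¹ : Sˣ) : S) := by
      have := w.mul_inv
      rw [hw, add_mul, one_mul] at this
      exact eq_sub_of_add_eq this
    calc ((w⁻¹ : Sˣ) : S) = 1 - z * (1 - z * ((w⁻¹ : Sˣ) : S)) := by rw [← h, ← h]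
      _ = _ := by noncomm_ring
  induction u with
  | zero => exact ⟨0, by simp⟩
  | succ i ih =>
    obtain ⟨s, hs⟩ := ih
    refine ⟨s + z * s + (i : ℤ) • 1, ?_⟩
    rw [add_comm, zpow_one_add, Units.val_mul, hs, hw]
    simp only [mul_add, add_mul, mul_one, one_mul, mul_smul_comm, mul_assoc]
    module
  | pred i ih =>
    obtain ⟨s, hs⟩ := ih
    refine ⟨s - z * s - (-i : ℤ) • 1 + ((w⁻¹ : Sˣ) : S) * ((w ^ (-i : ℤ) : Sˣ) : S), ?_⟩
    rw [sub_eq_neg_add, zpow_add, zpow_neg_one, Units.val_mul]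
    nth_rw 1 [hinv]
    rw [add_mul, mul_add, mul_assoc (z * z)]
    nth_rw 1 [hs]
    simp only [mul_add, mul_sub, sub_mul, mul_one, one_mul, mul_smul_comm, mul_assoc]
    module

end Filtration

/-! ### Homomorphisms from cyclic groups -/

section CyclicHom

variable {G : Type*} [Group G]

/-- The homomorphism from the cyclic group of order `n` that maps the generator to `x`. -/
def zmodPowersHom (n : ℕ) (x : G) (h : x ^ n = 1) : Multiplicative (ZMod n) →* G :=
  AddMonoidHom.toMultiplicativeLeft
    (ZMod.lift n ⟨zmultiplesHom (Additive G) (Additive.ofMul x), by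
      simp only [zmultiplesHom_apply, natCast_zsmul]
      exact congrArg Additive.ofMul h⟩)

theorem zmodPowersHom_intCast (n : ℕ) (x : G) (h : x ^ n = 1) (e : ℤ) :
    zmodPowersHom n x h (Multiplicative.ofAdd (e : ZMod n)) = x ^ e := by
  simp [zmodPowersHom]

theorem zmodPowersHom_one (n : ℕ) (x : G) (h : x ^ n = 1) :
    zmodPowersHom n x h (Multiplicative.ofAdd 1) = x := by
  simpa using zmodPowersHom_intCast n x h 1

end CyclicHom

/-! ### The Magnus representation of a free product of cyclic groups -/

namespace Magnus

variable {ι : Type*} [DecidableEq ι]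

/-- The number of letters `i` at the beginning of a word. -/
def headRun (i : ι) : List ι → ℕ
  | [] => 0
  | j :: w => if j = i then headRun i w + 1 else 0

/-- The number of blocks, that is, of maximal constant subwords, of a word. -/
def blocks : List ι → ℕ
  | [] => 0
  | i :: w => if w.head? = some i then blocks w else blocks w + 1

theorem headRun_eq_zero {i : ι} {w : List ι} (h : w.head? ≠ some i) : headRun i w = 0 := by
  cases w with
  | nil => rfl
  | cons j w =>
    rw [headRun, if_neg]
    rintro rfl
    exact h rfl

theorem headRun_replicate_append {i : ι} {w : List ι} (h : w.head? ≠ some i) (r : ℕ) :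
    headRun i (List.replicate r i ++ w) = r := by
  induction r with
  | zero => simpa using headRun_eq_zero h
  | succ r ih => rw [List.replicate_succ, List.cons_append, headRun, if_pos rfl, ih]

theorem blocks_replicate_append {i : ι} {w : List ι} (h : w.head? ≠ some i) (r : ℕ) :
    blocks (List.replicate (r + 1) i ++ w) = blocks w + 1 := by
  induction r with
  | zero => simp [blocks, h]
  | succ r ih =>
    rw [List.replicate_succ, List.cons_append, blocks, if_pos, ih]
    rw [List.replicate_succ, List.cons_append, List.head?_cons]

variable (q : ι → ℕ)

/-- A word that starts with a letter `i` survives if the block of letters `i` at its beginning is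
shorter than `q i`, where `q i = 0` stands for no restriction. -/
abbrev Admissible (i j : ι) (w : List ι) : Prop :=
  j = i ∧ (q i = 0 ∨ headRun i w + 1 < q i)

variable (K : Type*) [Field K]

/-- Left multiplication by the variable `X i` on the formal power series in noncommuting variables
`X i` subject to the relations `X i ^ q i = 0` for `q i ≠ 0`. -/
def mulX (i : ι) : Module.End K (List ι → K) where
  toFun f
    | [] => 0
    | j :: w => if Admissible q i j w then f w else 0
  map_add' f g := by
    funext w
    cases w with
    | nil => exact (add_zero 0).symm
    | cons j w =>
      simp only [Pi.add_apply]
      split_ifs <;> simp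
  map_smul' c f := by
    funext w
    cases w with
    | nil => exact (mul_zero c).symm
    | cons j w =>
      simp only [Pi.smul_apply, RingHom.id_apply]
      split_ifs <;> simp

variable {K}

theorem mulX_nil (i : ι) (f : List ι → K) : mulX q K i f [] = 0 := rfl

theorem mulX_cons (i : ι) (f : List ι → K) (j : ι) (w : List ι) :
    mulX q K i f (j :: w) = if Admissible q i j w then f w else 0 := rfl

/-- The coefficients of `(1 + X i)⁻¹ * f`. -/
def invAux (i : ι) (f : List ι → K) : List ι → K
  | [] => f []
  | j :: w => f (j :: w) - if Admissible q i j w then invAux i f w else 0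

variable (K) in
/-- Left multiplication by `(1 + X i)⁻¹`. -/
def invMul (i : ι) : Module.End K (List ι → K) where
  toFun f := invAux q i f
  map_add' f g := by
    funext w
    induction w with
    | nil => rfl
    | cons j w ih =>
      simp only [invAux, Pi.add_apply, ih]
      split_ifs <;> ring
  map_smul' c f := by
    funext w
    induction w with
    | nil => rfl
    | cons j w ih =>
      simp only [invAux, Pi.smul_apply, ih, RingHom.id_apply, smul_eq_mul]
      split_ifs <;> ring

theorem invMul_nil (i : ι) (f : List ι → K) : invMul q K i f [] = f [] := rfl

theorem invMul_cons (i : ι) (f : List ι → K) (j : ι) (w : List ι) :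
    invMul q K i f (j :: w) =
      f (j :: w) - if Admissible q i j w then invMul q K i f w else 0 := rfl

variable (K) in
/-- Left multiplication by `1 + X i`, as a unit. -/
def unit (i : ι) : (Module.End K (List ι → K))ˣ where
  val := 1 + mulX q K i
  inv := invMul q K i
  val_inv := by
    ext f w
    cases w with
    | nil => simp [Module.End.mul_apply, LinearMap.add_apply, mulX_nil, invMul_nil]
    | cons j w =>
      simp only [Module.End.mul_apply, LinearMap.add_apply, Module.End.one_apply, Pi.add_apply,
        mulX_cons, invMul_cons]
      split_ifs <;> simp
  inv_val := by
    ext f w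
    simp only [Module.End.mul_apply, Module.End.one_apply]
    induction w with
    | nil => simp [LinearMap.add_apply, mulX_nil, invMul_nil]
    | cons j w ih =>
      rw [invMul_cons, ih]
      simp only [LinearMap.add_apply, Module.End.one_apply, Pi.add_apply, mulX_cons]
      split_ifs <;> simp

theorem val_unit (i : ι) : ((unit q K i : (Module.End K (List ι → K))ˣ) : Module.End K _) =
    1 + mulX q K i := rfl

theorem val_inv_unit (i : ι) : (((unit q K i)⁻¹ : (Module.End K (List ι → K))ˣ) :
    Module.End K _) = invMul q K i := rfl

theorem mulX_pow_apply_eq_zero_of_headRun_lt {i : ι} {r : ℕ} {w : List ι} (h : headRun i w < r)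
    (f : List ι → K) : (mulX q K i ^ r) f w = 0 := by
  induction r generalizing w with
  | zero => omega
  | succ r ih =>
    rw [pow_succ', Module.End.mul_apply]
    cases w with
    | nil => exact mulX_nil q i _
    | cons j w =>
      rw [mulX_cons]
      split_ifs with hj
      · refine ih ?_
        rw [headRun, if_pos hj.1] at h
        omega
      · rfl

theorem mulX_pow_eq_zero {i : ι} (h : q i ≠ 0) : mulX q K i ^ q i = 0 := by
  ext f w
  by_cases hw : headRun i w < q i
  · exact mulX_pow_apply_eq_zero_of_headRun_lt q hw f
  · obtain ⟨r, hr⟩ := Nat.exists_eq_succ_of_ne_zero h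
    rw [hr, pow_succ', Module.End.mul_apply]
    cases w with
    | nil => exact mulX_nil q i _
    | cons j w =>
      rw [mulX_cons, if_neg]
      · rfl
      · rintro ⟨rfl, h0 | h1⟩
        · exact h h0
        · rw [headRun, if_pos rfl] at hw
          exact hw h1

theorem mulX_pow_apply_replicate_append {i : ι} {r : ℕ} (hr : q i = 0 ∨ r < q i) {w : List ι}
    (hw : w.head? ≠ some i) (f : List ι → K) :
    (mulX q K i ^ r) f (List.replicate r i ++ w) = f w := by
  induction r with
  | zero => rfl
  | succ r ih =>
    rw [pow_succ', Module.End.mul_apply, List.replicate_succ, List.cons_append, mulX_cons, if_pos]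
    · exact ih (by omega)
    · refine ⟨rfl, ?_⟩
      rwa [headRun_replicate_append hw]

/-- The series whose coefficients at all words in `E` vanish. -/
def vanishing (K : Type*) [Field K] (E : Set (List ι)) : Submodule K (List ι → K) where
  carrier := {f | ∀ w ∈ E, f w = 0}
  zero_mem' _ _ := rfl
  add_mem' hf hg w hw := by rw [Pi.add_apply, hf w hw, hg w hw, add_zero]
  smul_mem' c f hf w hw := by rw [Pi.smul_apply, hf w hw, smul_zero]

theorem mulX_mem_vanishing {i : ι} {E F : Set (List ι)} (h : ∀ w, i :: w ∈ F → w ∈ E)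
    {f : List ι → K} (hf : f ∈ vanishing K E) : mulX q K i f ∈ vanishing K F := by
  intro w hw
  cases w with
  | nil => rfl
  | cons j w =>
    rw [mulX_cons]
    split_ifs with hj
    · obtain ⟨rfl, -⟩ := hj
      exact hf w (h w hw)
    · rfl

/-- The coefficient of `(1 + X i)⁻¹ * f` at `w` involves `f` only at words obtained from `w` by
deleting leading letters `i`. -/
theorem invMul_mem_vanishing {i : ι} {E : Set (List ι)} (h : ∀ w, i :: w ∈ E → w ∈ E)
    {f : List ι → K} (hf : f ∈ vanishing K E) : invMul q K i f ∈ vanishing K E := by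
  intro w
  induction w with
  | nil => exact fun hw => hf _ hw
  | cons j w ih =>
    intro hw
    rw [invMul_cons, hf _ hw]
    split_ifs with hj
    · obtain ⟨rfl, -⟩ := hj
      rw [ih (h w hw), sub_zero]
    · exact sub_zero 0

theorem unit_zpow_mem_vanishing {i : ι} {E : Set (List ι)} (h : ∀ w, i :: w ∈ E → w ∈ E)
    {f : List ι → K} (hf : f ∈ vanishing K E) (e : ℤ) :
    ((unit q K i ^ e : (Module.End K (List ι → K))ˣ) : Module.End K _) f ∈ vanishing K E := by
  induction e with
  | zero => simpa using hf
  | succ e ih =>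
    rw [add_comm, zpow_one_add, Units.val_mul, Module.End.mul_apply, val_unit]
    exact add_mem ih (mulX_mem_vanishing q h ih)
  | pred e ih =>
    rw [sub_eq_neg_add, zpow_add, zpow_neg_one, Units.val_mul, Module.End.mul_apply, val_inv_unit]
    exact invMul_mem_vanishing q h ih

end Magnus

/-! ### Ping-pong and faithfulness of the Magnus representation -/

namespace Magnus

variable {ι : Type*} [DecidableEq ι] (q : ι → ℕ) {K : Type*} [Field K]

/-- The nonzero series with a bounded number of blocks whose words with the maximal number of
blocks start with `i`. -/
def pingPongSet (K : Type*) [Field K] (i : ι) : Set (List ι → K) :=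
  {f | ∃ b, (∀ w, b < blocks w → f w = 0) ∧ (∃ w, blocks w = b ∧ f w ≠ 0) ∧
    ∀ w, blocks w = b → f w ≠ 0 → w.head? = some i}

theorem pingPongSet_nonempty (i : ι) : (pingPongSet K i).Nonempty := by
  refine ⟨Pi.single [i] 1, 1, fun w hw => ?_, ⟨[i], rfl, by simp⟩, fun w _ hw => ?_⟩
  · refine Pi.single_eq_of_ne ?_ _
    rintro rfl
    simp [blocks] at hw
  · by_contra h
    refine hw (Pi.single_eq_of_ne ?_ _)
    rintro rfl
    exact h rfl

theorem pairwise_disjoint_pingPongSet :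
    Pairwise (Function.onFun Disjoint (pingPongSet K : ι → Set (List ι → K))) := by
  intro i j hij
  refine Set.disjoint_left.mpr ?_
  rintro f ⟨b, hb, ⟨w, hwb, hw⟩, hi⟩ ⟨c, hc, ⟨v, hvc, hv⟩, hj⟩
  have hcb : c = b := by
    refine le_antisymm ?_ ?_
    · by_contra! h
      exact hv (hb v (by omega))
    · by_contra! h
      exact hw (hc w (by omega))
  subst hcb
  exact hij (Option.some_injective _ ((hi w hwb hw).symm.trans (hj w hwb hw)))

/-- A power of `1 + X i` adds at most one block, a block of letters `i` in front. If `w` is a word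
of the support of `f` with the most blocks, then the new coefficient at `i ^ r w` is `u * f w`:
there `f` itself vanishes for having too many blocks, and the second order term needs `2 * r`
leading letters `i`. -/
theorem apply_mem_pingPongSet {i j : ι} (hij : i ≠ j) {r : ℕ} (hr0 : r ≠ 0)
    (hr : q i = 0 ∨ r < q i) {e u : ℤ} (hu : (u : K) ≠ 0) {s : Module.End K (List ι → K)}
    (h : ((unit q K i ^ e : (Module.End K (List ι → K))ˣ) : Module.End K (List ι → K)) =
      1 + u • mulX q K i ^ r + mulX q K i ^ r * mulX q K i ^ r * s)
    {f : List ι → K} (hf : f ∈ pingPongSet K j) :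
    ((unit q K i ^ e : (Module.End K (List ι → K))ˣ) : Module.End K (List ι → K)) f ∈
      pingPongSet K i := by
  obtain ⟨b, hb, ⟨w, hwb, hw⟩, hj⟩ := hf
  -- This set of words is stable under deleting a leading `i` and contains only words with more than
  -- `b` blocks.
  have hmem : f ∈ vanishing K {w : List ι | b + 1 < blocks w ∨
      blocks w = b + 1 ∧ w.head? ≠ some i} := by
    rintro v (hv | hv) <;> exact hb v (by omega)
  have hmem' := unit_zpow_mem_vanishing q (i := i) (by
    rintro v (hv | hv)
    · by_cases hvi : v.head? = some i
      · rw [blocks, if_pos hvi] at hv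
        exact Or.inl hv
      · rw [blocks, if_neg hvi] at hv
        by_cases hvb : blocks v = b + 1
        · exact Or.inr ⟨hvb, hvi⟩
        · exact Or.inl (by omega)
    · exact absurd rfl hv.2) hmem e
  have hwi : w.head? ≠ some i := by
    rw [hj w hwb hw]
    intro h
    exact hij (Option.some_injective _ h).symm
  obtain ⟨r', rfl⟩ := Nat.exists_eq_succ_of_ne_zero hr0
  refine ⟨b + 1, fun v hv => hmem' v (Or.inl hv), ⟨List.replicate (r' + 1) i ++ w, ?_, ?_⟩,
    fun v hvb hv => ?_⟩
  · rw [blocks_replicate_append hwi, hwb]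
  · rw [h]
    simp only [LinearMap.add_apply, Pi.add_apply, Module.End.one_apply, LinearMap.smul_apply,
      Pi.smul_apply]
    rw [hb _ (by rw [blocks_replicate_append hwi]; omega),
      mulX_pow_apply_replicate_append q hr hwi, ← pow_add, Module.End.mul_apply,
      mulX_pow_apply_eq_zero_of_headRun_lt q (by
        rw [headRun_replicate_append hwi]; omega), zero_add, add_zero, zsmul_eq_mul]
    exact mul_ne_zero hu hw
  · by_contra hvi
    exact hv (hmem' v (Or.inr ⟨hvb, hvi⟩))

variable {p : ℕ} [Fact p.Prime] [CharP K p]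

/-- Frobenius in characteristic `p`; this is where prime power orders matter. -/
theorem unit_pow_prime_pow (i : ι) (k : ℕ) :
    ((unit q K i ^ p ^ k : (Module.End K (List ι → K))ˣ) : Module.End K (List ι → K)) =
      1 + mulX q K i ^ p ^ k := by
  have : CharP (Module.End K (List ι → K)) p := charP_of_injective_algebraMap
    (FaithfulSMul.algebraMap_injective K (Module.End K (List ι → K))) p
  rw [Units.val_pow_eq_pow_val, val_unit,
    add_pow_char_pow_of_commute (p := p) _ (Commute.one_left _), one_pow]

variable {q}

theorem unit_pow_eq_one (hq : ∀ i, q i = 0 ∨ ∃ k, q i = p ^ k) (i : ι) :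
    unit q K i ^ q i = 1 := by
  rcases hq i with h | ⟨k, h⟩
  · rw [h, pow_zero]
  · have hne : q i ≠ 0 := h ▸ pow_ne_zero k (Fact.out : p.Prime).ne_zero
    ext1
    have := unit_pow_prime_pow q (K := K) (p := p) i k
    rw [← h, mulX_pow_eq_zero q hne, add_zero] at this
    exact this

variable (K) in
/-- The Magnus representation of a free product of cyclic groups of infinite or `p`-power order. -/
noncomputable def rep (hq : ∀ i, q i = 0 ∨ ∃ k, q i = p ^ k) (i : ι) :
    Multiplicative (ZMod (q i)) →* (Module.End K (List ι → K))ˣ :=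
  zmodPowersHom (q i) (unit q K i) (unit_pow_eq_one hq i)

theorem exists_rep_eq (hq : ∀ i, q i = 0 ∨ ∃ k, q i = p ^ k) (i : ι)
    (x : Multiplicative (ZMod (q i))) : ∃ e : ℤ, x = Multiplicative.ofAdd (e : ZMod (q i)) ∧
      rep K hq i x = unit q K i ^ e := by
  obtain ⟨e, he⟩ := ZMod.intCast_surjective (Multiplicative.toAdd x)
  have hx : x = Multiplicative.ofAdd (e : ZMod (q i)) := Multiplicative.toAdd.injective he.symm
  refine ⟨e, hx, ?_⟩
  rw [hx]
  exact zmodPowersHom_intCast _ _ _ _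

/-- Write the exponent as `e = p ^ a * u` with `p ∤ u`. Then `(1 + X i) ^ e = (1 + X i ^ p ^ a) ^ u`
has leading term `u • X i ^ p ^ a`, where `u ≠ 0` in `K`, and `p ^ a < q i` for finite order because
`q i ∤ e`. -/
theorem rep_mem_pingPongSet (hq : ∀ i, q i = 0 ∨ ∃ k, q i = p ^ k) {i j : ι} (hij : i ≠ j)
    {x : Multiplicative (ZMod (q i))} (hx : x ≠ 1) {f : List ι → K} (hf : f ∈ pingPongSet K j) :
    rep K hq i x • f ∈ pingPongSet K i := by
  have hp : p.Prime := Fact.out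
  obtain ⟨e, rfl, he⟩ := exists_rep_eq (K := K) hq i x
  have hndvd : ¬ (q i : ℤ) ∣ e := by
    intro h
    rw [(ZMod.intCast_zmod_eq_zero_iff_dvd e (q i)).mpr h] at hx
    exact hx rfl
  have he0 : e ≠ 0 := by
    rintro rfl
    exact hndvd (dvd_zero _)
  have hfin : FiniteMultiplicity (p : ℤ) e :=
    Int.finiteMultiplicity_iff.mpr ⟨by simpa using hp.ne_one, he0⟩
  obtain ⟨u, hu, hpu⟩ := hfin.exists_eq_pow_mul_and_not_dvd
  set a := multiplicity (p : ℤ) e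
  obtain ⟨s, hs⟩ := exists_val_zpow_eq (unit_pow_prime_pow q (K := K) (p := p) i a) u
  have hpow : (unit q K i ^ p ^ a) ^ u = unit q K i ^ e := by
    rw [← zpow_natCast, ← zpow_mul, hu]
    push_cast
    rfl
  rw [hpow] at hs
  rw [he, Units.smul_def, Module.End.smul_def]
  refine apply_mem_pingPongSet q hij (pow_ne_zero a hp.ne_zero) ?_ ?_ hs hf
  · refine (hq i).imp_right ?_
    rintro ⟨k, hk⟩
    rw [hk]
    refine Nat.pow_lt_pow_right hp.one_lt ?_
    by_contra! hka
    refine hndvd ?_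
    rw [hk, hu]
    push_cast
    exact (pow_dvd_pow _ hka).mul_right u
  · rwa [Ne, CharP.intCast_eq_zero_iff K p]

variable (K) in
theorem lift_rep_injective (hq : ∀ i, q i = 0 ∨ ∃ k, q i = p ^ k) [Nontrivial ι]
    (h0 : ∃ i, q i = 0) : Function.Injective (Monoid.CoprodI.lift (rep K hq)) := by
  refine Monoid.CoprodI.lift_injective_of_ping_pong (rep K hq) ?_ (pingPongSet K)
    pingPongSet_nonempty pairwise_disjoint_pingPongSet ?_
  -- The ping-pong lemma asks for three factors or a factor with at least three elements; the
  -- infinite factor serves.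
  · obtain ⟨i, hi⟩ := h0
    refine Or.inr ⟨i, ?_⟩
    have : Infinite (Multiplicative (ZMod (q i))) := by
      rw [hi]
      exact inferInstanceAs (Infinite ℤ)
    exact (Cardinal.natCast_lt_aleph0 (n := 3)).le.trans (Cardinal.aleph0_le_mk _)
  · intro i j hij x hx
    rintro _ ⟨f, hf, rfl⟩
    exact rep_mem_pingPongSet hq hij hx hf

/-- The endomorphisms that raise the order of vanishing of every series by at least `k`. -/
def orderFiltration (ι K : Type*) [Field K] (k : ℕ) :
    AddSubgroup (Module.End K (List ι → K)) where
  carrier := {T | ∀ c, ∀ f ∈ vanishing K {w : List ι | w.length < c},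
    T f ∈ vanishing K {w : List ι | w.length < c + k}}
  zero_mem' _ _ _ := zero_mem _
  add_mem' hS hT c f hf := add_mem (hS c f hf) (hT c f hf)
  neg_mem' hT c f hf := neg_mem (hT c f hf)

/-- Only the units `1 + X i` need checking: `X i` raises the order of vanishing by one, and `(1 + X
i)⁻¹ - 1 = -X i * (1 + X i)⁻¹`. -/
theorem lift_rep_mem_congruenceUnits (hq : ∀ i, q i = 0 ∨ ∃ k, q i = p ^ k)
    {h1 : 1 ∈ orderFiltration ι K 0}
    {hmul : ∀ j k x y, x ∈ orderFiltration ι K j → y ∈ orderFiltration ι K k →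
      x * y ∈ orderFiltration ι K (j + k)}
    {hle : ∀ k, orderFiltration ι K k ≤ orderFiltration ι K 0}
    (x : Monoid.CoprodI fun i => Multiplicative (ZMod (q i))) :
    Monoid.CoprodI.lift (rep K hq) x ∈ congruenceUnits (orderFiltration ι K) h1 hmul hle 1 := by
  induction x using Monoid.CoprodI.induction_on with
  | one =>
    rw [map_one]
    exact one_mem _
  | of i x =>
    obtain ⟨e, -, he⟩ := exists_rep_eq (K := K) hq i x
    rw [Monoid.CoprodI.lift_of, he]
    have hu : unit q K i ∈ congruenceUnits (orderFiltration ι K) h1 hmul hle 1 := by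
      refine ⟨?_, ?_⟩
      · intro c f hf
        rw [val_unit, add_sub_cancel_left]
        exact mulX_mem_vanishing q (fun w hw => by
          simp only [Set.mem_ofPred_eq, List.length_cons] at hw ⊢; omega) hf
      · intro c f hf
        have h : invMul q K i - 1 = - (mulX q K i * invMul q K i) := by
          have := (unit q K i).mul_inv
          rw [val_unit, val_inv_unit, add_mul, one_mul] at this
          rw [← this]
          abel
        rw [val_inv_unit, h]
        refine neg_mem (mulX_mem_vanishing q (fun w hw => ?_) (invMul_mem_vanishing q ?_ hf))
        · simp only [Set.mem_ofPred_eq, List.length_cons] at hw ⊢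
          omega
        · intro w hw
          simp only [Set.mem_ofPred_eq, List.length_cons] at hw ⊢
          omega
    exact zpow_mem hu e
  | mul x y hx hy =>
    rw [map_mul]
    exact mul_mem hx hy

end Magnus

/-- A free product of at least two cyclic groups, each of infinite order or of order a power of the
prime `p`, at least one of them infinite, is residually nilpotent. -/
theorem gammaOmega_coprodI_zmod_eq_bot {ι : Type*} [Nontrivial ι] {p : ℕ} (hp : p.Prime)
    {q : ι → ℕ} (hq : ∀ i, q i = 0 ∨ ∃ k, q i = p ^ k) (h0 : ∃ i, q i = 0) :
    gammaOmega (Monoid.CoprodI fun i => Multiplicative (ZMod (q i))) = ⊥ := by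
  classical
  have : Fact p.Prime := ⟨hp⟩
  refine gammaOmega_eq_bot_of_congruenceUnits (I := Magnus.orderFiltration ι (ZMod p))
    (h1 := fun c f hf => hf) (hmul := fun j k x y hx hy c f hf => ?_)
    (hle := fun k T hT c f hf w hw => hT c f hf w ?_)
    (Magnus.lift_rep_injective (ZMod p) hq h0) (Magnus.lift_rep_mem_congruenceUnits hq)
    fun T hT => ?_
  · rw [add_comm j, ← add_assoc]
    exact hx _ _ (hy _ _ hf)
  · exact Nat.lt_of_lt_of_le hw (Nat.add_le_add_left (Nat.zero_le k) c)
  · ext f w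
    exact hT w.length 0 f (fun v hv => absurd hv (Nat.not_lt_zero _)) w
      (show w.length < 0 + (w.length + 1) by omega)

/-! ### Residual properties of free groups and their finite extensions -/

section FreeGroupResidual

theorem gammaOmega_eq_bot_of_injective {G H : Type*} [Group G] [Group H] {f : G →* H}
    (hf : Function.Injective f) (hH : gammaOmega H = ⊥) : gammaOmega G = ⊥ := by
  rw [eq_bot_iff, ← (MonoidHom.ker_eq_bot_iff f).mpr hf]
  exact gammaOmega_le_ker f hH

/-- A free group is a free product of infinite cyclic groups `ZMod 0`, for which any prime will do.
-/
theorem gammaOmega_freeGroup_eq_bot (α : Type*) [Nontrivial α] :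
    gammaOmega (FreeGroup α) = ⊥ := by
  let f : FreeGroup α →* Monoid.CoprodI fun _ : α => Multiplicative (ZMod 0) :=
    FreeGroup.lift fun x => Monoid.CoprodI.of (i := x) (Multiplicative.ofAdd (1 : ZMod 0))
  let g : (Monoid.CoprodI fun _ : α => Multiplicative (ZMod 0)) →* FreeGroup α :=
    Monoid.CoprodI.lift fun x => zmodPowersHom 0 (FreeGroup.of x) (pow_zero _)
  have hgf : g.comp f = MonoidHom.id _ := by
    ext x
    simp [f, g, zmodPowersHom_one]
  exact gammaOmega_eq_bot_of_injective (f := f)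
    (Function.LeftInverse.injective (g := g) fun x => DFunLike.congr_fun hgf x)
    (gammaOmega_coprodI_zmod_eq_bot Nat.prime_two (q := fun _ => 0) (fun _ => Or.inl rfl)
      ⟨Classical.arbitrary α, rfl⟩)

/-- Free groups of finite rank are residually finite. -/
theorem finiteResidual_freeGroup_eq_bot (α : Type*) [Finite α] [Nontrivial α] :
    finiteResidual (FreeGroup α) = ⊥ := by
  rw [eq_bot_iff, ← gammaOmega_freeGroup_eq_bot α]
  exact finiteResidual_le_gammaOmega

/-- Since `H` is finite, the residual lies in `N`, and finite index subgroups of `N` have finite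
index in the whole group. -/
theorem finiteResidual_semidirectProduct_eq_bot {N H : Type*} [Group N] [Group H] [Finite H]
    {φ : H →* MulAut N} (hN : finiteResidual N = ⊥) : finiteResidual (N ⋊[φ] H) = ⊥ := by
  refine eq_bot_iff.mpr fun x hx => ?_
  have hH : finiteResidual H = ⊥ := by
    refine eq_bot_iff.mpr ?_
    exact sInf_le (show (⊥ : Subgroup H).FiniteIndex from inferInstance)
  have h1 : SemidirectProduct.rightHom x = 1 := finiteResidual_le_ker _ hH hx
  have h2 : x ∈ (SemidirectProduct.inl : N →* N ⋊[φ] H).range := by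
    rw [SemidirectProduct.range_inl_eq_ker_rightHom]
    exact h1
  obtain ⟨y, rfl⟩ := h2
  have hy : y ∈ finiteResidual N := by
    refine Subgroup.mem_sInf.mpr fun K hK => ?_
    have hK' : K.FiniteIndex := hK
    have hfin : (K.map (SemidirectProduct.inl : N →* N ⋊[φ] H)).FiniteIndex := by
      refine ⟨?_⟩
      rw [Subgroup.index_map_of_injective K SemidirectProduct.inl_injective,
        SemidirectProduct.range_inl_eq_ker_rightHom, Subgroup.index_ker]
      exact mul_ne_zero hK'.index_ne_zero Nat.card_pos.ne'
    obtain ⟨z, hz, hzy⟩ := Subgroup.mem_sInf.mp hx _ hfin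
    rwa [← SemidirectProduct.inl_injective hzy]
  rw [hN, Subgroup.mem_bot] at hy
  rw [hy, map_one]
  exact one_mem _

end FreeGroupResidual

/-! ### The free product of an infinite cyclic group with a group -/

namespace CoprodInt

open Monoid SemidirectProduct

variable (A : Type*) [Group A]

/-- The action of `A` on the free group with basis `A` by left translation of the basis. -/
def translation : A →* MulAut (FreeGroup A) where
  toFun g := FreeGroup.freeGroupCongr (Equiv.mulLeft g)
  map_one' := by
    ext x
    simp
  map_mul' g h := by
    refine MulEquiv.ext fun x => ?_
    rw [MulAut.mul_apply, ← MulEquiv.trans_apply, FreeGroup.freeGroupCongr_trans]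
    congr 2
    ext y
    simp

theorem translation_of (g x : A) : translation A g (FreeGroup.of x) = FreeGroup.of (g * x) := by
  simp [translation]

/-- The free product of `ℤ` and `A` is a semidirect product of a free group with basis `A`,
formed by the conjugates of the generator of `ℤ`, and the group `A`. -/
def equivSemidirectProduct :
    Coprod (Multiplicative ℤ) A ≃* FreeGroup A ⋊[translation A] A :=
  MonoidHom.toMulEquiv
    (Coprod.lift (zpowersHom _ (inl (FreeGroup.of 1))) inr)
    (SemidirectProduct.lift
      (FreeGroup.lift fun x => Coprod.inr x * Coprod.inl (Multiplicative.ofAdd 1) *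
        (Coprod.inr x)⁻¹)
      Coprod.inr (by
        intro g
        ext x
        simp [translation_of, mul_assoc]))
    (by
      refine Coprod.hom_ext ?_ ?_
      · ext
        simp
      · ext x
        simp)
    (by
      refine SemidirectProduct.hom_ext ?_ ?_
      · ext x : 1
        simp only [MonoidHom.comp_apply, lift_inl, FreeGroup.lift_apply_of, map_mul, map_inv,
          Coprod.lift_apply_inl, Coprod.lift_apply_inr, zpowersHom_apply, toAdd_ofAdd, zpow_one,
          MonoidHom.id_apply]
        rw [← map_inv, ← inl_aut, translation_of, mul_one]
      · ext x : 1
        simp)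

theorem equivSemidirectProduct_inl :
    equivSemidirectProduct A (Coprod.inl (Multiplicative.ofAdd 1)) = inl (FreeGroup.of 1) := by
  simp [equivSemidirectProduct]

theorem equivSemidirectProduct_inr (x : A) :
    equivSemidirectProduct A (Coprod.inr x) = inr x := by
  simp [equivSemidirectProduct]

/-- The action of `ℤ` on the free group with basis `ℤ × (A \ {1})` by translation of the basis. -/
def intTranslation :
    Multiplicative ℤ →* MulAut (FreeGroup (Multiplicative ℤ × {x : A // x ≠ 1})) where
  toFun g := FreeGroup.freeGroupCongr ((Equiv.mulLeft g).prodCongr (Equiv.refl _))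
  map_one' := by
    refine MulEquiv.ext fun x => ?_
    have : (Equiv.mulLeft (1 : Multiplicative ℤ)).prodCongr (Equiv.refl {x : A // x ≠ 1}) =
        Equiv.refl _ := by
      ext y <;> simp
    rw [this]
    simp
  map_mul' g h := by
    refine MulEquiv.ext fun x => ?_
    rw [MulAut.mul_apply, ← MulEquiv.trans_apply, FreeGroup.freeGroupCongr_trans]
    congr 2
    ext y <;> simp [mul_assoc]

theorem intTranslation_of (g k : Multiplicative ℤ) (x : {x : A // x ≠ 1}) :
    intTranslation A g (FreeGroup.of (k, x)) = FreeGroup.of (g * k, x) := by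
  simp [intTranslation]

open Classical in
/-- The free group with basis `A` is a semidirect product of a free group with basis
`ℤ × (A \ {1})`, formed by elements of exponent sum zero, and the infinite cyclic group generated
by the basis element `1`. -/
noncomputable def freeGroupEquivSemidirectProduct :
    FreeGroup A ≃* FreeGroup (Multiplicative ℤ × {x : A // x ≠ 1}) ⋊[intTranslation A]
      Multiplicative ℤ :=
  MonoidHom.toMulEquiv
    (FreeGroup.lift fun x => if h : x = 1 then inr (Multiplicative.ofAdd 1) else
      inl (FreeGroup.of (1, ⟨x, h⟩)) * inr (Multiplicative.ofAdd 1))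
    (SemidirectProduct.lift
      -- `FreeGroup.of 1` is the letter indexed by `1 : A`, not the identity.
      (FreeGroup.lift fun y => FreeGroup.of 1 ^ y.1.toAdd *
        (FreeGroup.of y.2.1 * (FreeGroup.of 1)⁻¹) * (FreeGroup.of 1 ^ y.1.toAdd)⁻¹)
      (zpowersHom _ (FreeGroup.of 1)) (by
        intro g
        ext ⟨k, x⟩ : 1
        simp only [MonoidHom.comp_apply, MulEquiv.coe_toMonoidHom, intTranslation_of,
          FreeGroup.lift_apply_of, MulAut.conj_apply, zpowersHom_apply, toAdd_mul, zpow_add]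
        group))
    (by
      ext x : 1
      by_cases h : x = 1
      · subst h
        simp
      · simp [h])
    (by
      refine SemidirectProduct.hom_ext ?_ ?_
      · ext ⟨k, x, hx⟩ : 1
        have hk : (inr (Multiplicative.ofAdd 1) : FreeGroup (Multiplicative ℤ ×
            {x : A // x ≠ 1}) ⋊[intTranslation A] Multiplicative ℤ) ^ k.toAdd = inr k := by
          rw [← map_zpow, ← ofAdd_zsmul, smul_eq_mul, mul_one, ofAdd_toAdd]
        simp only [MonoidHom.comp_apply, lift_inl, FreeGroup.lift_apply_of, map_mul, map_inv,
          map_zpow, dif_pos, dif_neg hx, MonoidHom.id_apply, hk, mul_inv_cancel_right]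
        rw [← map_inv, ← inl_aut, intTranslation_of, mul_one]
      · refine MonoidHom.ext_mint ?_
        simp)

theorem rightHom_freeGroupEquivSemidirectProduct_of (x : A) :
    rightHom (freeGroupEquivSemidirectProduct A (FreeGroup.of x)) = Multiplicative.ofAdd 1 := by
  by_cases h : x = 1 <;> simp [freeGroupEquivSemidirectProduct, h]

/-- The embedding of a free group with basis `ℤ × (A \ {1})` into the free product of `ℤ` and `A`
whose image is the kernel of the projection to the direct product. -/
noncomputable def kerEmbedding :
    FreeGroup (Multiplicative ℤ × {x : A // x ≠ 1}) →* Coprod (Multiplicative ℤ) A :=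
  (equivSemidirectProduct A).symm.toMonoidHom.comp
    (inl.comp ((freeGroupEquivSemidirectProduct A).symm.toMonoidHom.comp inl))

theorem kerEmbedding_injective : Function.Injective (kerEmbedding A) :=
  (equivSemidirectProduct A).symm.injective.comp (inl_injective.comp
    ((freeGroupEquivSemidirectProduct A).symm.injective.comp inl_injective))

theorem snd_equivSemidirectProduct_symm (x : FreeGroup A ⋊[translation A] A) :
    Coprod.snd ((equivSemidirectProduct A).symm x) = x.right := by
  have h : (Coprod.snd : Coprod (Multiplicative ℤ) A →* A) =
      rightHom.comp (equivSemidirectProduct A).toMonoidHom := by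
    refine Coprod.hom_ext ?_ ?_
    · ext
      simp [equivSemidirectProduct_inl]
    · ext x
      simp [equivSemidirectProduct_inr]
  rw [h]
  simp

theorem fst_equivSemidirectProduct_symm_inl (x : FreeGroup A) :
    Coprod.fst ((equivSemidirectProduct A).symm (inl x)) =
      rightHom (freeGroupEquivSemidirectProduct A x) := by
  have h : (Coprod.fst : Coprod (Multiplicative ℤ) A →* _).comp
      ((equivSemidirectProduct A).symm.toMonoidHom.comp inl) =
        rightHom.comp (freeGroupEquivSemidirectProduct A).toMonoidHom := by
    ext x : 1
    simp only [MonoidHom.comp_apply, MulEquiv.coe_toMonoidHom,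
      rightHom_freeGroupEquivSemidirectProduct_of]
    simp [equivSemidirectProduct]
  exact DFunLike.congr_fun h x

/-- A trivial `A`-component puts an element into `FreeGroup A`, and there the `ℤ`-component is the
total exponent sum. -/
theorem range_kerEmbedding :
    (kerEmbedding A).range = (Coprod.toProd : Coprod (Multiplicative ℤ) A →* _).ker := by
  ext x
  rw [MonoidHom.mem_ker, ← Coprod.prod_mk_fst_snd, Prod.mk_eq_one]
  constructor
  · rintro ⟨y, rfl⟩
    refine ⟨?_, ?_⟩
    · simp [kerEmbedding, fst_equivSemidirectProduct_symm_inl]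
    · simp [kerEmbedding, snd_equivSemidirectProduct_symm]
  · rintro ⟨h1, h2⟩
    obtain ⟨y, rfl⟩ := (equivSemidirectProduct A).symm.surjective x
    rw [snd_equivSemidirectProduct_symm] at h2
    have hy : y ∈ (inl : FreeGroup A →* FreeGroup A ⋊[translation A] A).range := by
      rw [range_inl_eq_ker_rightHom]
      exact h2
    obtain ⟨z, rfl⟩ := hy
    rw [fst_equivSemidirectProduct_symm_inl] at h1
    have hz : freeGroupEquivSemidirectProduct A z ∈ (inl : _ →* FreeGroup (Multiplicative ℤ ×
        {x : A // x ≠ 1}) ⋊[intTranslation A] Multiplicative ℤ).range := by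
      rw [range_inl_eq_ker_rightHom]
      exact h1
    obtain ⟨v, hv⟩ := hz
    refine ⟨v, ?_⟩
    simp [kerEmbedding, hv]

/-- The kernel of the projection of the free product of `ℤ` and a nontrivial countable group to the
direct product is a free group of countably infinite rank. -/
theorem nonempty_ker_toProd_mulEquiv [Countable A] [Nontrivial A] :
    Nonempty ((Coprod.toProd : Coprod (Multiplicative ℤ) A →* _).ker ≃* FreeGroup ℕ) := by
  have : Nonempty {x : A // x ≠ 1} := (exists_ne (1 : A)).elim fun x hx => ⟨⟨x, hx⟩⟩
  have : Infinite (Multiplicative ℤ × {x : A // x ≠ 1}) := inferInstance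
  have : Countable (Multiplicative ℤ) := inferInstanceAs (Countable ℤ)
  obtain ⟨e⟩ := nonempty_equiv_of_countable (α := Multiplicative ℤ × {x : A // x ≠ 1}) (β := ℕ)
  exact ⟨(MulEquiv.subgroupCongr (range_kerEmbedding A)).symm.trans
    ((MonoidHom.ofInjective (kerEmbedding_injective A)).symm.trans (FreeGroup.freeGroupCongr e))⟩

theorem finiteResidual_eq_bot [Finite A] [Nontrivial A] :
    finiteResidual (Coprod (Multiplicative ℤ) A) = ⊥ :=
  finiteResidual_eq_bot_of_injective (f := (equivSemidirectProduct A).toMonoidHom)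
    (equivSemidirectProduct A).injective
    (finiteResidual_semidirectProduct_eq_bot (finiteResidual_freeGroup_eq_bot A))

theorem gammaOmega_zmod_prime_pow_eq_bot {p : ℕ} (hp : p.Prime) (k : ℕ) :
    gammaOmega (Coprod (Multiplicative ℤ) (Multiplicative (ZMod (p ^ k)))) = ⊥ := by
  let q : Bool → ℕ := fun b => if b then p ^ k else 0
  let f : Coprod (Multiplicative ℤ) (Multiplicative (ZMod (p ^ k))) →*
      CoprodI fun b => Multiplicative (ZMod (q b)) :=
    Coprod.lift (zpowersHom _ (CoprodI.of (i := false) (Multiplicative.ofAdd (1 : ZMod 0))))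
      (CoprodI.of (M := fun b => Multiplicative (ZMod (q b))) (i := true))
  let g : (CoprodI fun b => Multiplicative (ZMod (q b))) →*
      Coprod (Multiplicative ℤ) (Multiplicative (ZMod (p ^ k))) :=
    CoprodI.lift fun b => match b with
      | false => zmodPowersHom 0 (Coprod.inl (Multiplicative.ofAdd 1)) (pow_zero _)
      | true => Coprod.inr
  have hgf : g.comp f = MonoidHom.id _ := by
    refine Coprod.hom_ext ?_ ?_
    · ext
      simp only [f, g, MonoidHom.comp_apply, Coprod.lift_apply_inl, zpowersHom_apply, toAdd_ofAdd,
        zpow_one, MonoidHom.id_apply]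
      erw [CoprodI.lift_of]
    · refine MonoidHom.ext fun x => ?_
      simp only [f, g, MonoidHom.comp_apply, Coprod.lift_apply_inr, MonoidHom.id_apply]
      erw [CoprodI.lift_of]
  exact gammaOmega_eq_bot_of_injective (f := f)
    (Function.LeftInverse.injective (g := g) fun x => DFunLike.congr_fun hgf x)
    (gammaOmega_coprodI_zmod_eq_bot hp
      (fun b => match b with
        | false => Or.inl rfl
        | true => Or.inr ⟨k, rfl⟩) ⟨false, rfl⟩)

end CoprodInt

/-! ### Cyclic subgroups in finite quotients -/

section CyclicSubgroups

open Subgroup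

/-- A subgroup `L` of a finite cyclic group is the kernel of `x ↦ x ^ Nat.card L`, by counting. -/
theorem IsCyclic.subgroup_eq_of_card_eq {C : Type*} [CommGroup C] [IsCyclic C] [Finite C]
    {H K : Subgroup C} (h : Nat.card H = Nat.card K) : H = K := by
  have key : ∀ L : Subgroup C, L = (powMonoidHom (Nat.card L) : C →* C).ker := by
    intro L
    refine eq_of_le_of_card_ge (fun x hx => ?_) ?_
    · rw [MonoidHom.mem_ker, powMonoidHom_apply]
      exact congrArg Subtype.val (pow_card_eq_one' (x := (⟨x, hx⟩ : L)))
    · rw [IsCyclic.card_powMonoidHom_ker]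
      exact Nat.gcd_le_right _ Nat.card_pos
  rw [key H, h, ← key K]

variable {Γ : Type*} [Group Γ]

open scoped IsMulCommutative in
/-- In a finite group, if `α ^ m` and `α ^ n` are conjugate, then they generate the same cyclic
subgroup. -/
theorem zpowers_zpow_eq_zpowers_gcd_of_conj [Finite Γ] {α τ : Γ} {m n : ℤ}
    (h : τ⁻¹ * α ^ m * τ = α ^ n) :
    zpowers (α ^ m) = zpowers (α ^ Int.gcd m n) ∧ zpowers (α ^ n) = zpowers (α ^ Int.gcd m n) := by
  have hcard : orderOf (α ^ m) = orderOf (α ^ n) := by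
    rw [← h]
    have := MulEquiv.orderOf_eq (MulAut.conj τ⁻¹) (α ^ m)
    simpa using this.symm
  have hmn : zpowers (α ^ m) = zpowers (α ^ n) := by
    let β : zpowers α := ⟨α, mem_zpowers α⟩
    have hβ : ∀ k : ℤ, (zpowers (β ^ k)).map (zpowers α).subtype = zpowers (α ^ k) := by
      intro k
      rw [MonoidHom.map_zpowers, map_zpow]
      rfl
    have hord : ∀ k : ℤ, Nat.card (zpowers (β ^ k)) = orderOf (α ^ k) := by
      intro k
      rw [Nat.card_zpowers, ← Subgroup.orderOf_coe]
      rfl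
    rw [← hβ m, ← hβ n]
    refine congrArg _ (IsCyclic.subgroup_eq_of_card_eq (C := zpowers α) ?_)
    rw [hord, hord, hcard]
  have hle : zpowers (α ^ n) ≤ zpowers (α ^ Int.gcd m n) := by
    rw [zpowers_le]
    obtain ⟨k, hk⟩ := Int.gcd_dvd_right m n
    refine mem_zpowers_iff.mpr ⟨k, ?_⟩
    rw [← zpow_natCast, ← zpow_mul, ← hk]
  have hge : zpowers (α ^ Int.gcd m n) ≤ zpowers (α ^ n) := by
    rw [zpowers_le, ← zpow_natCast, Int.gcd_eq_gcd_ab, zpow_add, zpow_mul, zpow_mul]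
    refine mul_mem (zpow_mem ?_ _) (zpow_mem (mem_zpowers _) _)
    rw [← hmn]
    exact mem_zpowers _
  exact ⟨hmn.trans (le_antisymm hle hge), le_antisymm hle hge⟩

/-- Conjugation by `τ⁻¹` carries `⟨α ^ m⟩` to `⟨α ^ n⟩`, and both are `⟨α ^ d⟩`; so `τ` normalizes
it. -/
theorem zpow_conj_pow_gcd_mem_zpowers [Finite Γ] {α τ : Γ} {m n : ℤ}
    (h : τ⁻¹ * α ^ m * τ = α ^ n) (k : ℤ) :
    τ ^ k * α ^ Int.gcd m n * τ ^ (-k) ∈ zpowers (α ^ Int.gcd m n) := by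
  obtain ⟨h1, h2⟩ := zpowers_zpow_eq_zpowers_gcd_of_conj h
  have hτ : τ⁻¹ ∈ normalizer (zpowers (α ^ Int.gcd m n) : Set Γ) := by
    rw [mem_normalizer_iff_map_conj_eq]
    nth_rw 1 [← h1]
    rw [MonoidHom.map_zpowers, ← h2, ← h]
    simp
  have := (mem_normalizer_iff.mp (zpow_mem (inv_mem_iff.mp hτ) k) (α ^ Int.gcd m n)).mp
    (mem_zpowers _)
  rwa [zpow_neg]

/-- Two elements whose images in every finite quotient are powers of the same element commute
modulo the finite residual. -/
theorem mul_comm_quotient_finiteResidual {x u v : Γ}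
    (hu : ∀ N : Subgroup Γ, ∀ _ : N.Normal, N.FiniteIndex → (u : Γ ⧸ N) ∈ zpowers (x : Γ ⧸ N))
    (hv : ∀ N : Subgroup Γ, ∀ _ : N.Normal, N.FiniteIndex → (v : Γ ⧸ N) ∈ zpowers (x : Γ ⧸ N)) :
    (u : Γ ⧸ finiteResidual Γ) * v = v * u := by
  rw [← QuotientGroup.mk_mul, ← QuotientGroup.mk_mul, QuotientGroup.eq]
  refine mem_sInf.mpr fun H hH => H.normalCore_le ?_
  have hH' : H.FiniteIndex := hH
  rw [← QuotientGroup.eq, QuotientGroup.mk_mul, QuotientGroup.mk_mul]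
  obtain ⟨i, hi⟩ := mem_zpowers_iff.mp (hu H.normalCore inferInstance inferInstance)
  obtain ⟨j, hj⟩ := mem_zpowers_iff.mp (hv H.normalCore inferInstance inferInstance)
  rw [← hi, ← hj, ← zpow_add, ← zpow_add, add_comm]

theorem nonempty_quotient_mulEquiv {H : Type*} [Group H] {N : Subgroup Γ} [N.Normal] {f : Γ →* H}
    (hf : Function.Surjective f) (hN : f.ker = N) : Nonempty (Γ ⧸ N ≃* H) :=
  ⟨(QuotientGroup.quotientMulEquivOfEq hN.symm).trans
    (QuotientGroup.quotientKerEquivOfSurjective f hf)⟩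

end CyclicSubgroups

/-! ### The Baumslag-Solitar group and its subgroup `A` -/

namespace BS

open Subgroup

variable {m n : ℤ}

theorem relation : (t m n)⁻¹ * a m n ^ m * t m n = a m n ^ n :=
  mul_inv_eq_one.mp (PresentedGroup.one_of_mem (Set.mem_singleton _))

/-- The homomorphism from `BS(m, n)` that maps `a` to `x` and `t` to `y`. -/
def lift {H : Type*} [Group H] (x y : H) (h : y⁻¹ * x ^ m * y = x ^ n) : BS m n →* H :=
  PresentedGroup.toGroup (f := fun
    | BSGen.a => x
    | BSGen.t => y) (by
    rintro _ rfl
    simp [h])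

section

variable {H : Type*} [Group H] {x y : H} {h : y⁻¹ * x ^ m * y = x ^ n}

@[simp]
theorem lift_a : lift x y h (a m n) = x := PresentedGroup.toGroup.of _

@[simp]
theorem lift_t : lift x y h (t m n) = y := PresentedGroup.toGroup.of _

theorem hom_ext {f g : BS m n →* H} (ha : f (a m n) = g (a m n)) (ht : f (t m n) = g (t m n)) :
    f = g := by
  refine PresentedGroup.ext fun x => ?_
  cases x
  · exact ha
  · exact ht

end

theorem closure_eq_top : closure {a m n, t m n} = ⊤ := by
  rw [eq_top_iff, ← PresentedGroup.closure_range_of, closure_le]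
  rintro _ ⟨x, rfl⟩
  cases x
  · exact subset_closure (Or.inl rfl)
  · exact subset_closure (Or.inr rfl)

instance : Group.FG (BS m n) :=
  Group.fg_iff.mpr ⟨_, closure_eq_top, Set.toFinite _⟩

theorem conj_mem_zpowers (k : ℤ) (N : Subgroup (BS m n)) (_ : N.Normal) (_ : N.FiniteIndex) :
    ((t m n ^ k * a m n ^ Int.gcd m n * t m n ^ (-k) : BS m n) : BS m n ⧸ N) ∈
      zpowers (a m n : BS m n ⧸ N) := by
  have h : ((t m n : BS m n ⧸ N))⁻¹ * (a m n : BS m n ⧸ N) ^ m * (t m n : BS m n ⧸ N) =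
      (a m n : BS m n ⧸ N) ^ n := congrArg (QuotientGroup.mk (s := N)) relation
  refine zpowers_le.mpr ?_ (zpow_conj_pow_gcd_mem_zpowers h k)
  exact pow_mem (mem_zpowers _) _

/-- Modulo the residual, `a` commutes with these elements and `t` shifts their index by one. Having
`s` independent of `k` lets the shift be undone for `g⁻¹`. -/
theorem exists_conj_eq (g : BS m n) : ∃ s : ℤ, ∀ k : ℤ,
    ((g * (t m n ^ k * a m n ^ Int.gcd m n * t m n ^ (-k)) * g⁻¹ : BS m n) :
        BS m n ⧸ finiteResidual (BS m n)) =
      (t m n ^ (k + s) * a m n ^ Int.gcd m n * t m n ^ (-(k + s)) : BS m n) := by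
  have hg : g ∈ closure {a m n, t m n} := closure_eq_top ▸ mem_top g
  induction hg using closure_induction with
  | mem g hg =>
    rcases hg with rfl | rfl
    · refine ⟨0, fun k => ?_⟩
      rw [add_zero, QuotientGroup.mk_mul, QuotientGroup.mk_mul, QuotientGroup.mk_inv,
        mul_comm_quotient_finiteResidual (fun _ _ _ => mem_zpowers _) (conj_mem_zpowers k),
        mul_inv_cancel_right]
    · refine ⟨1, fun k => congrArg _ ?_⟩
      group
  | one => exact ⟨0, fun k => by simp⟩
  | mul g h _ _ hg hh =>
    obtain ⟨s, hs⟩ := hg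
    obtain ⟨r, hr⟩ := hh
    refine ⟨r + s, fun k => ?_⟩
    have e : g * h * (t m n ^ k * a m n ^ Int.gcd m n * t m n ^ (-k)) * (g * h)⁻¹ =
        g * (h * (t m n ^ k * a m n ^ Int.gcd m n * t m n ^ (-k)) * h⁻¹) * g⁻¹ := by
      simp only [mul_inv_rev, mul_assoc]
    rw [← add_assoc, ← hs, e, QuotientGroup.mk_mul, QuotientGroup.mk_mul, hr]
    rfl
  | inv g _ hg =>
    obtain ⟨s, hs⟩ := hg
    refine ⟨-s, fun k => ?_⟩
    have := hs (k + -s)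
    rw [neg_add_cancel_right] at this
    rw [QuotientGroup.mk_mul, QuotientGroup.mk_mul, ← this]
    simp only [QuotientGroup.mk_mul, QuotientGroup.mk_inv, inv_inv, mul_assoc,
      inv_mul_cancel_left, inv_mul_cancel, mul_one]

instance Abar_normal : (Abar m n).Normal := by
  refine ⟨fun x hx g => ?_⟩
  obtain ⟨g, rfl⟩ := QuotientGroup.mk_surjective g
  obtain ⟨s, hs⟩ := exists_conj_eq g
  induction hx using closure_induction with
  | mem x hx =>
    obtain ⟨k, rfl⟩ := hx
    exact subset_closure ⟨k + s, (hs k).symm⟩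
  | one => simp
  | mul x y _ _ hx hy =>
    rw [← conj_mul]
    exact mul_mem hx hy
  | inv x _ hx =>
    rw [← conj_inv]
    exact inv_mem hx

instance A_normal : (A m n).Normal := inferInstanceAs ((Abar m n).comap _).Normal

theorem finiteResidual_le_A : finiteResidual (BS m n) ≤ A m n := by
  intro x hx
  rw [A, mem_comap, QuotientGroup.mk'_apply, (QuotientGroup.eq_one_iff x).mpr hx]
  exact one_mem _

theorem mul_comm_of_mem_Abar {x y : BS m n ⧸ finiteResidual (BS m n)} (hx : x ∈ Abar m n)
    (hy : y ∈ Abar m n) : x * y = y * x := by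
  have h : IsMulCommutative (Abar m n) := by
    refine isMulCommutative_closure ?_
    rintro _ ⟨i, rfl⟩ _ ⟨j, rfl⟩
    exact mul_comm_quotient_finiteResidual (conj_mem_zpowers i) (conj_mem_zpowers j)
  exact congrArg Subtype.val (h.is_comm.comm ⟨x, hx⟩ ⟨y, hy⟩)

theorem mul_comm_A_quotient_finiteResidual
    (x y : A m n ⧸ (finiteResidual (BS m n)).subgroupOf (A m n)) : x * y = y * x := by
  obtain ⟨x, rfl⟩ := QuotientGroup.mk_surjective x
  obtain ⟨y, rfl⟩ := QuotientGroup.mk_surjective y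
  rw [← QuotientGroup.mk_mul, ← QuotientGroup.mk_mul, QuotientGroup.eq, mem_subgroupOf]
  exact QuotientGroup.eq.mp (mul_comm_of_mem_Abar x.2 y.2)

theorem pow_gcd_mem_A : a m n ^ Int.gcd m n ∈ A m n :=
  subset_closure ⟨0, by simp⟩

/-! ### The quotient of `BS(m, n)` by `A` -/

variable (m n) in
/-- The homomorphism from `BS(m, n)` to the free product of an infinite cyclic group generated by
the image of `t` and a cyclic group of order `gcd m n` generated by the image of `a`. -/
def toCoprod :
    BS m n →* Monoid.Coprod (Multiplicative ℤ) (Multiplicative (ZMod (Int.gcd m n))) :=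
  lift (Monoid.Coprod.inr (Multiplicative.ofAdd 1)) (Monoid.Coprod.inl (Multiplicative.ofAdd 1)) (by
    have h : ∀ k : ℤ, (Int.gcd m n : ℤ) ∣ k →
        (Multiplicative.ofAdd (1 : ZMod (Int.gcd m n))) ^ k = 1 := by
      intro k hk
      rw [← ofAdd_zsmul, zsmul_one, (ZMod.intCast_zmod_eq_zero_iff_dvd k _).mpr hk, ofAdd_zero]
    rw [← map_zpow (Monoid.Coprod.inr (M := Multiplicative ℤ)),
      ← map_zpow (Monoid.Coprod.inr (M := Multiplicative ℤ)), h m (Int.gcd_dvd_left m n), h n (Int.gcd_dvd_right m n)]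
    simp)

theorem toCoprod_a : toCoprod m n (a m n) = Monoid.Coprod.inr (Multiplicative.ofAdd 1) := lift_a

theorem toCoprod_t : toCoprod m n (t m n) = Monoid.Coprod.inl (Multiplicative.ofAdd 1) := lift_t

theorem toCoprod_surjective : Function.Surjective (toCoprod m n) := by
  rw [← MonoidHom.range_eq_top, eq_top_iff, ← Monoid.Coprod.range_inl_sup_range_inr, sup_le_iff]
  constructor
  · rintro _ ⟨x, rfl⟩
    refine ⟨t m n ^ x.toAdd, ?_⟩
    rw [map_zpow, toCoprod_t, ← map_zpow, ← ofAdd_zsmul, smul_eq_mul, mul_one, ofAdd_toAdd]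
  · rintro _ ⟨x, rfl⟩
    obtain ⟨i, hi⟩ := ZMod.intCast_surjective (Multiplicative.toAdd x)
    refine ⟨a m n ^ i, ?_⟩
    rw [map_zpow, toCoprod_a, ← map_zpow, ← ofAdd_zsmul, zsmul_one, hi, ofAdd_toAdd]

theorem toCoprod_pow_gcd : toCoprod m n (a m n ^ Int.gcd m n) = 1 := by
  rw [map_pow, toCoprod_a, ← map_pow, ← ofAdd_nsmul, nsmul_one, ZMod.natCast_self, ofAdd_zero,
    map_one]

/-- The universal property of the free product gives a map `r` back to the quotient by the normal
closure, and `r` after `toCoprod` is the projection. -/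
theorem ker_toCoprod : (toCoprod m n).ker = normalClosure {a m n ^ Int.gcd m n} := by
  refine le_antisymm ?_ (normalClosure_le_normal (Set.singleton_subset_iff.mpr toCoprod_pow_gcd))
  set N := normalClosure {a m n ^ Int.gcd m n}
  have hN : (a m n : BS m n ⧸ N) ^ Int.gcd m n = 1 :=
    (QuotientGroup.eq_one_iff _).mpr (subset_normalClosure (Set.mem_singleton _))
  let r : Monoid.Coprod (Multiplicative ℤ) (Multiplicative (ZMod (Int.gcd m n))) →* BS m n ⧸ N :=
    Monoid.Coprod.lift (zpowersHom _ (t m n : BS m n ⧸ N)) (zmodPowersHom _ _ hN)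
  have hr : r.comp (toCoprod m n) = QuotientGroup.mk' N := by
    refine hom_ext ?_ ?_
    · rw [MonoidHom.comp_apply, toCoprod_a, Monoid.Coprod.lift_apply_inr, zmodPowersHom_one]
      rfl
    · rw [MonoidHom.comp_apply, toCoprod_t, Monoid.Coprod.lift_apply_inl]
      simp
  intro x hx
  rw [← QuotientGroup.ker_mk' N, ← hr, MonoidHom.mem_ker, MonoidHom.comp_apply,
    MonoidHom.mem_ker.mp hx, map_one]

theorem finiteResidual_coprod_eq_bot (hm : m ≠ 0) : finiteResidual
    (Monoid.Coprod (Multiplicative ℤ) (Multiplicative (ZMod (Int.gcd m n)))) = ⊥ := by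
  have hpos : 0 < Int.gcd m n := Int.gcd_pos_of_ne_zero_left n hm
  have hfg : Group.FG (Monoid.Coprod (Multiplicative ℤ) (Multiplicative (ZMod (Int.gcd m n)))) :=
    Group.fg_of_surjective (toCoprod_surjective (m := m) (n := n))
  -- For `d = 1` the second factor is trivial and the semidirect product argument, which needs a
  -- free group of rank at least two, is replaced by residual nilpotence with `1 = 2 ^ 0`.
  rcases eq_or_ne (Int.gcd m n) 1 with h | h
  · rw [eq_bot_iff]
    refine finiteResidual_le_gammaOmega.trans ?_
    rw [h]
    exact (CoprodInt.gammaOmega_zmod_prime_pow_eq_bot Nat.prime_two 0).le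
  · have : NeZero (Int.gcd m n) := ⟨hpos.ne'⟩
    have : Fact (1 < Int.gcd m n) := ⟨by omega⟩
    have : Finite (Multiplicative (ZMod (Int.gcd m n))) := inferInstanceAs (Finite (ZMod _))
    exact CoprodInt.finiteResidual_eq_bot _

/-- Residual finiteness of the target puts `R` into the kernel, so inclusion of `A` can be tested on
the generators of `Abar`. -/
theorem ker_toCoprod_eq_A (hm : m ≠ 0) : (toCoprod m n).ker = A m n := by
  refine le_antisymm ?_ ?_
  · rw [ker_toCoprod]
    exact normalClosure_le_normal (Set.singleton_subset_iff.mpr pow_gcd_mem_A)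
  · have hR := finiteResidual_le_ker (toCoprod m n) (finiteResidual_coprod_eq_bot hm)
    have hle : Abar m n ≤ (toCoprod m n).ker.map (QuotientGroup.mk' (finiteResidual (BS m n))) := by
      rw [Abar, closure_le]
      rintro _ ⟨k, rfl⟩
      refine mem_map_of_mem _ ?_
      rw [zpow_neg]
      exact (MonoidHom.normal_ker _).conj_mem _ toCoprod_pow_gcd _
    refine (comap_mono hle).trans ?_
    rw [QuotientGroup.comap_map_mk', sup_eq_right.mpr hR]

/-! ### Abelian quotients of `BS(m, n)` -/

/-- The homomorphism from `BS(m, n)` to `ℤ × ℤ / e` given by the exponent sums of `t` and `a`,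
for a divisor `e` of `n - m`. -/
def expSum (e : ℕ) (he : (e : ℤ) ∣ n - m) :
    BS m n →* Multiplicative ℤ × Multiplicative (ZMod e) :=
  lift (1, Multiplicative.ofAdd 1) (Multiplicative.ofAdd 1, 1) (by
    have h : (Multiplicative.ofAdd (1 : ZMod e)) ^ m = Multiplicative.ofAdd 1 ^ n := by
      rw [← ofAdd_zsmul, ← ofAdd_zsmul, zsmul_one, zsmul_one,
        (ZMod.intCast_eq_intCast_iff_dvd_sub m n e).mpr he]
    rw [mul_assoc, mul_comm, mul_inv_cancel_right, Prod.pow_mk, Prod.pow_mk, h, one_zpow, one_zpow])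

theorem expSum_zpow_mul_zpow {e : ℕ} (he : (e : ℤ) ∣ n - m) (i j : ℤ) :
    expSum e he (a m n ^ i * t m n ^ j) =
      (Multiplicative.ofAdd j, Multiplicative.ofAdd (i : ZMod e)) := by
  rw [map_mul, map_zpow, map_zpow, expSum, lift_a, lift_t, Prod.pow_mk, Prod.pow_mk, Prod.mk_mul_mk,
    one_zpow, one_zpow, one_mul, mul_one, ← ofAdd_zsmul, ← ofAdd_zsmul, zsmul_one, zsmul_one,
    Int.cast_id]

theorem expSum_surjective {e : ℕ} (he : (e : ℤ) ∣ n - m) :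
    Function.Surjective (expSum e he) := by
  rintro ⟨x, y⟩
  obtain ⟨i, hi⟩ := ZMod.intCast_surjective (Multiplicative.toAdd y)
  refine ⟨a m n ^ i * t m n ^ x.toAdd, ?_⟩
  rw [expSum_zpow_mul_zpow, hi]
  rfl

theorem exists_zpow_mul_zpow_inv_mul_mem_commutator (g : BS m n) :
    ∃ i j : ℤ, (a m n ^ i * t m n ^ j)⁻¹ * g ∈ commutator (BS m n) := by
  have key : ∃ i j : ℤ, Abelianization.of g =
      Abelianization.of (a m n) ^ i * Abelianization.of (t m n) ^ j := by
    have hg : g ∈ closure {a m n, t m n} := closure_eq_top ▸ mem_top g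
    induction hg using closure_induction with
    | mem g hg =>
      rcases hg with rfl | rfl
      · exact ⟨1, 0, by simp⟩
      · exact ⟨0, 1, by simp⟩
    | one => exact ⟨0, 0, by simp⟩
    | mul g h _ _ hg hh =>
      obtain ⟨i, j, hg⟩ := hg
      obtain ⟨k, l, hh⟩ := hh
      refine ⟨i + k, j + l, ?_⟩
      rw [map_mul, hg, hh, zpow_add, zpow_add, mul_mul_mul_comm]
    | inv g _ hg =>
      obtain ⟨i, j, hg⟩ := hg
      refine ⟨-i, -j, ?_⟩
      rw [map_inv, hg, mul_inv, zpow_neg, zpow_neg]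
  obtain ⟨i, j, h⟩ := key
  refine ⟨i, j, ?_⟩
  rw [← Abelianization.ker_of, MonoidHom.mem_ker, map_mul, map_inv, map_mul, map_zpow, map_zpow, h,
    inv_mul_cancel]

/-- Modulo commutators every element is `a ^ i * t ^ j`, which is killed only if `j = 0` and `e ∣
i`. Used for `N = G'` and for `N = G'A`. -/
theorem ker_expSum_eq {e : ℕ} (he : (e : ℤ) ∣ n - m) {N : Subgroup (BS m n)}
    (hcomm : commutator (BS m n) ≤ N) (ha : a m n ^ e ∈ N) (hN : N ≤ (expSum e he).ker) :
    (expSum e he).ker = N := by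
  refine le_antisymm (fun g hg => ?_) hN
  obtain ⟨i, j, hc⟩ := exists_zpow_mul_zpow_inv_mul_mem_commutator g
  have h1 : expSum e he (a m n ^ i * t m n ^ j) = 1 := by
    have := MonoidHom.mem_ker.mp (hN (hcomm hc))
    rwa [map_mul, map_inv, MonoidHom.mem_ker.mp hg, mul_one, inv_eq_one] at this
  rw [expSum_zpow_mul_zpow, Prod.mk_eq_one, ofAdd_eq_one, ofAdd_eq_one,
    ZMod.intCast_zmod_eq_zero_iff_dvd] at h1
  obtain ⟨rfl, k, rfl⟩ := h1
  have h2 : a m n ^ (e * k : ℤ) * t m n ^ (0 : ℤ) ∈ N := by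
    rw [zpow_zero, mul_one, zpow_mul, zpow_natCast]
    exact zpow_mem ha k
  have := mul_mem h2 (hcomm hc)
  rwa [mul_inv_cancel_left] at this

open scoped commutatorElement in
theorem zpow_sub_eq_commutatorElement : a m n ^ (n - m) = ⁅(a m n ^ m)⁻¹, (t m n)⁻¹⁆ := by
  rw [commutatorElement_def, inv_inv, inv_inv, sub_eq_neg_add, zpow_add, zpow_neg]
  exact (congrArg ((a m n ^ m)⁻¹ * ·) relation.symm).trans (by simp only [mul_assoc])

theorem zpow_sub_mem_commutator : a m n ^ (n - m) ∈ commutator (BS m n) := by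
  rw [zpow_sub_eq_commutatorElement]
  exact commutator_mem_commutator (mem_top _) (mem_top _)

theorem pow_natAbs_mem_commutator : a m n ^ (n - m).natAbs ∈ commutator (BS m n) := by
  rcases Int.natAbs_eq (n - m) with h | h
  · rw [← zpow_natCast, ← h]
    exact zpow_sub_mem_commutator
  · have := inv_mem (zpow_sub_mem_commutator (m := m) (n := n))
    rwa [← zpow_neg (a m n), show -(n - m) = ((n - m).natAbs : ℤ) by omega, zpow_natCast] at this

theorem ker_expSum_natAbs :
    (expSum (m := m) (n := n) (n - m).natAbs Int.natAbs_dvd_self).ker = commutator (BS m n) :=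
  ker_expSum_eq _ le_rfl pow_natAbs_mem_commutator (Abelianization.commutator_subset_ker _)

theorem gcd_dvd_sub : (Int.gcd m n : ℤ) ∣ n - m :=
  dvd_sub (Int.gcd_dvd_right m n) (Int.gcd_dvd_left m n)

theorem expSum_gcd_eq :
    expSum (m := m) (n := n) (Int.gcd m n) gcd_dvd_sub =
      Monoid.Coprod.toProd.comp (toCoprod m n) := by
  refine hom_ext ?_ ?_
  · rw [expSum, lift_a, MonoidHom.comp_apply, toCoprod_a, Monoid.Coprod.toProd_apply_inr]
  · rw [expSum, lift_t, MonoidHom.comp_apply, toCoprod_t, Monoid.Coprod.toProd_apply_inl]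

theorem ker_expSum_gcd (hm : m ≠ 0) :
    (expSum (m := m) (n := n) (Int.gcd m n) gcd_dvd_sub).ker = commutator (BS m n) ⊔ A m n := by
  refine ker_expSum_eq _ le_sup_left (le_sup_right (a := commutator (BS m n)) pow_gcd_mem_A)
    (sup_le (Abelianization.commutator_subset_ker _) ?_)
  rw [← ker_toCoprod_eq_A hm, expSum_gcd_eq]
  intro x hx
  rw [MonoidHom.mem_ker, MonoidHom.comp_apply, MonoidHom.mem_ker.mp hx, map_one]

/-- Under `G / A ≅ ℤ * ℤ_d`, the subgroup `G'A / A` becomes the kernel of the map to `ℤ × ℤ_d`. -/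
theorem nonempty_commutator_sup_A_quotient_mulEquiv (hm : m ≠ 0) (hd : 1 < Int.gcd m n) :
    Nonempty ((commutator (BS m n) ⊔ A m n : Subgroup (BS m n)) ⧸
      (A m n).subgroupOf (commutator (BS m n) ⊔ A m n) ≃* FreeGroup ℕ) := by
  have : Fact (1 < Int.gcd m n) := ⟨hd⟩
  have : NeZero (Int.gcd m n) := ⟨by omega⟩
  have : Countable (Multiplicative (ZMod (Int.gcd m n))) := inferInstanceAs (Countable (ZMod _))
  obtain ⟨e⟩ := CoprodInt.nonempty_ker_toProd_mulEquiv (Multiplicative (ZMod (Int.gcd m n)))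
  have hker := ker_expSum_gcd (n := n) hm
  rw [expSum_gcd_eq] at hker
  let f : (commutator (BS m n) ⊔ A m n : Subgroup (BS m n)) →*
      (Monoid.Coprod.toProd : Monoid.Coprod (Multiplicative ℤ)
        (Multiplicative (ZMod (Int.gcd m n))) →* _).ker :=
    ((toCoprod m n).comp (Subgroup.subtype _)).codRestrict _ fun x =>
      hker.ge x.2
  have hf : Function.Surjective f := by
    rintro ⟨y, hy⟩
    obtain ⟨x, rfl⟩ := toCoprod_surjective y
    exact ⟨⟨x, hker ▸ hy⟩, rfl⟩
  have hfker : f.ker = (A m n).subgroupOf (commutator (BS m n) ⊔ A m n) := by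
    ext x
    rw [mem_subgroupOf, MonoidHom.mem_ker, Subtype.ext_iff]
    exact SetLike.ext_iff.mp (ker_toCoprod_eq_A hm) (x : BS m n)
  obtain ⟨e'⟩ := nonempty_quotient_mulEquiv hf hfker
  exact ⟨e'.trans e⟩

/-! ### The case of coprime `m` and `n` -/

variable (m n) in
/-- The exponent sum of `t`. -/
def expSumT : BS m n →* Multiplicative ℤ :=
  Monoid.Coprod.fst.comp (toCoprod m n)

theorem expSumT_surjective : Function.Surjective (expSumT m n) := by
  have h : Function.Surjective (Monoid.Coprod.fst : Monoid.Coprod (Multiplicative ℤ)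
      (Multiplicative (ZMod (Int.gcd m n))) →* _) :=
    fun x => ⟨Monoid.Coprod.inl x, Monoid.Coprod.fst_apply_inl x⟩
  exact h.comp toCoprod_surjective

theorem ker_expSumT (hm : m ≠ 0) (hd : Int.gcd m n = 1) : (expSumT m n).ker = A m n := by
  have : Subsingleton (Multiplicative (ZMod (Int.gcd m n))) := by
    rw [hd]
    exact inferInstanceAs (Subsingleton (ZMod 1))
  have hinj : Function.LeftInverse (Monoid.Coprod.inl : Multiplicative ℤ →*
      Monoid.Coprod (Multiplicative ℤ) (Multiplicative (ZMod (Int.gcd m n))))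
      Monoid.Coprod.fst := by
    refine DFunLike.congr_fun (f := Monoid.Coprod.inl.comp Monoid.Coprod.fst)
      (g := MonoidHom.id _) (Monoid.Coprod.hom_ext ?_ ?_)
    · ext
      simp
    · refine MonoidHom.ext fun x => ?_
      rw [Subsingleton.elim x 1, map_one, map_one]
  rw [← ker_toCoprod_eq_A hm]
  ext x
  rw [MonoidHom.mem_ker, MonoidHom.mem_ker, expSumT, MonoidHom.comp_apply,
    map_eq_one_iff _ hinj.injective]

theorem commutator_le_A (hm : m ≠ 0) (hd : Int.gcd m n = 1) : commutator (BS m n) ≤ A m n := by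
  rw [← ker_expSumT hm hd]
  exact Abelianization.commutator_subset_ker _

theorem a_mem_A (hd : Int.gcd m n = 1) : a m n ∈ A m n := by
  have := pow_gcd_mem_A (m := m) (n := n)
  rwa [hd, pow_one] at this

theorem fst_expSum {e : ℕ} (he : (e : ℤ) ∣ n - m) (x : BS m n) :
    (expSum e he x).1 = expSumT m n x := by
  refine DFunLike.congr_fun (f := (MonoidHom.fst _ _).comp (expSum e he)) (hom_ext ?_ ?_) x
  · simp [expSum, expSumT, toCoprod_a]
  · simp [expSum, expSumT, toCoprod_t]

theorem expSum_zpow {e : ℕ} (he : (e : ℤ) ∣ n - m) (i : ℤ) :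
    expSum e he (a m n ^ i) = (1, Multiplicative.ofAdd (i : ZMod e)) := by
  have := expSum_zpow_mul_zpow he i 0
  rwa [zpow_zero, mul_one] at this

theorem commutator_lt_A (hm : m ≠ 0) (hd : Int.gcd m n = 1) (hmn : 1 < n - m) :
    commutator (BS m n) < A m n := by
  refine lt_of_le_of_ne (commutator_le_A hm hd) fun h => ?_
  have h1 := a_mem_A hd
  rw [← h, ← ker_expSum_natAbs, MonoidHom.mem_ker, ← zpow_one (a m n), expSum_zpow,
    Prod.mk_eq_one, ofAdd_eq_one, ZMod.intCast_zmod_eq_zero_iff_dvd] at h1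
  have := Int.le_of_dvd one_pos h1.2
  omega

/-- On `A` the exponent sum of `t` is zero, so that of `a` modulo `n - m` alone detects `G'`. -/
theorem nonempty_A_quotient_commutator_mulEquiv (hm : m ≠ 0) (hd : Int.gcd m n = 1) :
    Nonempty (A m n ⧸ (commutator (BS m n)).subgroupOf (A m n) ≃*
      Multiplicative (ZMod (n - m).natAbs)) := by
  let f : A m n →* Multiplicative (ZMod (n - m).natAbs) :=
    (MonoidHom.snd _ _).comp ((expSum (n - m).natAbs Int.natAbs_dvd_self).comp (A m n).subtype)
  refine nonempty_quotient_mulEquiv (f := f) ?_ ?_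
  · intro y
    obtain ⟨i, hi⟩ := ZMod.intCast_surjective (Multiplicative.toAdd y)
    refine ⟨⟨a m n ^ i, zpow_mem (a_mem_A hd) i⟩, ?_⟩
    change (expSum (n - m).natAbs Int.natAbs_dvd_self (a m n ^ i)).2 = y
    rw [expSum_zpow, hi]
    rfl
  · ext x
    have hx : expSumT m n x = 1 := (ker_expSumT hm hd).ge x.2
    rw [mem_subgroupOf, ← ker_expSum_natAbs, MonoidHom.mem_ker, MonoidHom.mem_ker, Prod.ext_iff,
      fst_expSum]
    exact ⟨fun h => ⟨hx, h⟩, fun h => h.2⟩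

theorem A_le_of_pow_gcd_mem (hm : m ≠ 0) {N : Subgroup (BS m n)} [N.Normal]
    (h : a m n ^ Int.gcd m n ∈ N) : A m n ≤ N := by
  rw [← ker_toCoprod_eq_A hm, ker_toCoprod]
  exact normalClosure_le_normal (Set.singleton_subset_iff.mpr h)

theorem A_le_commutator (hm : m ≠ 0) (h : n - m = Int.gcd m n) : A m n ≤ commutator (BS m n) := by
  refine A_le_of_pow_gcd_mem hm ?_
  rw [← zpow_natCast, ← h]
  exact zpow_sub_mem_commutator

/-- The relation gives `a = ⁅a ^ (-m), t⁻¹⁆`, so `a` lies in each next term of the lower central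
series once it lies in one. -/
theorem A_le_gammaOmega (hm : m ≠ 0) (h : n - m = 1) (hd : Int.gcd m n = 1) :
    A m n ≤ gammaOmega (BS m n) := by
  refine le_iInf fun i => A_le_of_pow_gcd_mem hm ?_
  rw [hd, pow_one]
  induction i with
  | zero => exact mem_top _
  | succ i ih =>
    rw [Subgroup.lowerCentralSeries_succ, ← zpow_one (a m n), ← h, zpow_sub_eq_commutatorElement]
    exact commutator_mem_commutator (inv_mem (zpow_mem ih m)) (mem_top _)

theorem gammaOmega_le_A (hm : m ≠ 0) {p k : ℕ} (hp : p.Prime) (hd : Int.gcd m n = p ^ k) :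
    gammaOmega (BS m n) ≤ A m n := by
  rw [← ker_toCoprod_eq_A hm]
  refine gammaOmega_le_ker _ ?_
  rw [hd]
  exact CoprodInt.gammaOmega_zmod_prime_pow_eq_bot hp k

end BS

/-! ### The subgroup series and their factors -/

theorem proposition5 (m n : ℤ) (hm : 0 < m) (hmn : m ≤ |n|)
    (hG : ¬ Group.ResiduallyFinite (BS m n)) :
    -- the inclusions `G ≥ G'A ≥ A ≥ R` and `G ≥ G' ≥ γ_ω G ≥ R`
    (commutator (BS m n) ⊔ BS.A m n ≤ ⊤ ∧
      BS.A m n ≤ commutator (BS m n) ⊔ BS.A m n ∧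
      finiteResidual (BS m n) ≤ BS.A m n) ∧
    (commutator (BS m n) ≤ ⊤ ∧
      gammaOmega (BS m n) ≤ commutator (BS m n) ∧
      finiteResidual (BS m n) ≤ gammaOmega (BS m n)) ∧
    -- `A / R` is abelian
    (∀ x y : BS.A m n ⧸ (finiteResidual (BS m n)).subgroupOf (BS.A m n), x * y = y * x) ∧
    -- `A` is a normal subgroup of `G`, and the following holds
    ∃ _ : (BS.A m n).Normal,
      -- the case `n - m ≥ d > 1`
      ((Int.gcd m n : ℤ) ≤ n - m → 1 < Int.gcd m n →
        Nonempty (BS m n ⧸ (commutator (BS m n) ⊔ BS.A m n) ≃*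
          Multiplicative ℤ × Multiplicative (ZMod (Int.gcd m n))) ∧
        Nonempty (BS m n ⧸ BS.A m n ≃*
          Monoid.Coprod (Multiplicative ℤ) (Multiplicative (ZMod (Int.gcd m n)))) ∧
        Nonempty (BS m n ⧸ commutator (BS m n) ≃*
          Multiplicative ℤ × Multiplicative (ZMod (n - m).natAbs)) ∧
        Nonempty ((commutator (BS m n) ⊔ BS.A m n : Subgroup (BS m n)) ⧸
            (BS.A m n).subgroupOf (commutator (BS m n) ⊔ BS.A m n) ≃*
          FreeGroup ℕ)) ∧
      -- the case `n - m > d = 1`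
      ((Int.gcd m n : ℤ) < n - m → Int.gcd m n = 1 →
        commutator (BS m n) < BS.A m n ∧
        Nonempty (BS m n ⧸ BS.A m n ≃* Multiplicative ℤ) ∧
        Nonempty (BS.A m n ⧸ (commutator (BS m n)).subgroupOf (BS.A m n) ≃*
          Multiplicative (ZMod (n - m).natAbs))) ∧
      -- the case `n - m = d = 1`
      (n - m = (Int.gcd m n : ℤ) → Int.gcd m n = 1 →
        commutator (BS m n) = BS.A m n ∧ BS.A m n = gammaOmega (BS m n)) ∧
      -- the case where `d` is a power of a prime
      (∀ p k : ℕ, p.Prime → Int.gcd m n = p ^ k →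
        commutator (BS m n) ⊔ BS.A m n ≤ ⊤ ∧
        BS.A m n ≤ commutator (BS m n) ⊔ BS.A m n ∧
        gammaOmega (BS m n) ≤ BS.A m n ∧
        finiteResidual (BS m n) ≤ gammaOmega (BS m n)) ∧
      -- the case where `n = m + d` and `d` is a power of a prime
      (∀ p k : ℕ, p.Prime → Int.gcd m n = p ^ k → n = m + (Int.gcd m n : ℤ) →
        commutator (BS m n) ≤ ⊤ ∧
        BS.A m n ≤ commutator (BS m n) ∧
        gammaOmega (BS m n) ≤ BS.A m n ∧
        finiteResidual (BS m n) ≤ gammaOmega (BS m n)) := by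
  have hm0 : m ≠ 0 := hm.ne'
  refine ⟨⟨le_top, le_sup_right, BS.finiteResidual_le_A⟩,
    ⟨le_top, gammaOmega_le_commutator, finiteResidual_le_gammaOmega⟩,
    BS.mul_comm_A_quotient_finiteResidual, BS.A_normal, ?_, ?_, ?_, ?_, ?_⟩
  · intro _ hd
    exact ⟨nonempty_quotient_mulEquiv (BS.expSum_surjective _) (BS.ker_expSum_gcd hm0),
      nonempty_quotient_mulEquiv BS.toCoprod_surjective (BS.ker_toCoprod_eq_A hm0),
      nonempty_quotient_mulEquiv (BS.expSum_surjective _) BS.ker_expSum_natAbs,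
      BS.nonempty_commutator_sup_A_quotient_mulEquiv hm0 hd⟩
  · intro hdn hd
    exact ⟨BS.commutator_lt_A hm0 hd (by omega),
      nonempty_quotient_mulEquiv BS.expSumT_surjective (BS.ker_expSumT hm0 hd),
      BS.nonempty_A_quotient_commutator_mulEquiv hm0 hd⟩
  · intro hdn hd
    have hA := BS.A_le_gammaOmega hm0 (by omega : n - m = 1) hd
    exact ⟨le_antisymm (BS.commutator_le_A hm0 hd) (BS.A_le_commutator hm0 hdn),
      le_antisymm hA (gammaOmega_le_commutator.trans (BS.commutator_le_A hm0 hd))⟩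
  · intro p k hp hd
    exact ⟨le_top, le_sup_right, BS.gammaOmega_le_A hm0 hp hd, finiteResidual_le_gammaOmega⟩
  · intro p k hp hd hn
    exact ⟨le_top, BS.A_le_commutator hm0 (by omega), BS.gammaOmega_le_A hm0 hp hd,
      finiteResidual_le_gammaOmega⟩
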